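/- Let $M$ be a compact smooth manifold of dimension $n\ge 1$ with smooth non-empty boundary $\partial M$, and let $f:M\to[0,1]$ be a Morse function (a smooth function all of whose critical points are nondegenerate) such that $f^{-1}(1)=\partial M$ and $f$ has no local maximum in the interior of $M$. Write $M^a=\{x\in M: f(x)\le a\}$. Let $0\le c<d\le 1$ and $\lambda\in\{0,1,\dots,n-1\}$, and let $p\in f^{-1}(c)$ be a critical point of $f$ of index $\lambda$. Suppose that for some $\varepsilon_1>0$ the set $f^{-1}([c-\varepsilon_1,d])$ contains no critical point of $f$ other than $p$. Then there is $\varepsilon_0>0$ such that for every $\varepsilon\in(0,\varepsilon_0)$ there exists a smooth homotopy $$h:[0,1]\times M^d\to M^d$$ with the following properties: 1. $h(1,\cdot)$ is the identity map of $M^d$; 2. $h(0,M^d)$ is contained in $M^{c-\varepsilon}$ with a $\lambda$-cell attached, that is, $h(0,M^d)\subseteq M^{c-\varepsilon}\cup e$, where $e\subseteq M^d$ is the image of a smooth embedding $\Phi$ of the closed unit ball of $\mathbb R^\lambda$ with $e\cap M^{c-\varepsilon}=\Phi(S^{\lambda-1})$, the image of the unit sphere (for $\lambda=0$, $e$ is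 a point not in $M^{c-\varepsilon}$). -/

import Mathlib

open scoped Manifold ContDiff

noncomputable section

section Morse

variable {E : Type*} [NormedAddCommGroup E] [NormedSpace ℝ E]
  {H : Type*} [TopologicalSpace H] (I : ModelWithCorners ℝ E H)
  {M : Type*} [TopologicalSpace M] [ChartedSpace H M]

/-- `x` is a critical point of `f` if the differential of `f` vanishes at `x`. -/
def IsCriticalPt (f : M → ℝ) (x : M) : Prop :=
  mfderiv I 𝓘(ℝ, ℝ) f x = 0

/-- The Hessian of `f` at `x`, read in the preferred chart at `x`: the bilinear form
`(v, w) ↦ D²(f ∘ φ⁻¹)(φ x) v w`, where `φ = extChartAt I x`. Derivatives are taken within `range I`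
so that the expression makes sense at boundary points as well; at interior points they are the
usual derivatives. It is used at critical points only, where a change of chart merely replaces
it by a congruent form. -/
def chartHessian (f : M → ℝ) (x : M) : LinearMap.BilinForm ℝ E :=
  (fderivWithin ℝ (fderivWithin ℝ (f ∘ (extChartAt I x).symm) (Set.range I)) (Set.range I)
    (extChartAt I x x)).toLinearMap₁₂

/-- A Morse function: a smooth function all of whose critical points are nondegenerate. -/
structure IsMorseFunction (f : M → ℝ) : Prop where
  smooth : ContMDiff I 𝓘(ℝ, ℝ) ∞ f
  nondegenerate : ∀ x, IsCriticalPt I f x → (chartHessian I f x).Nondegenerate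

/-- The index of `f` at a critical point `x`: the maximal dimension of a subspace on which the
Hessian is negative definite. -/
def morseIndex (f : M → ℝ) (x : M) : ℕ :=
  sigNeg (chartHessian I f x).toQuadraticMap

/-- `e` is a `k`-cell attached to `A ⊆ M`, so that `A ∪ e` is `A` with a `k`-cell attached:
`e` is the image of a smooth embedding of the closed unit ball of `ℝᵏ` (a smooth injective
map with injective differential) that meets `A` exactly in the image of the unit sphere. -/
def IsAttachedCell (k : ℕ) (A e : Set M) : Prop :=
  ∃ Φ : EuclideanSpace ℝ (Fin k) → M,
    ContMDiffOn 𝓘(ℝ, EuclideanSpace ℝ (Fin k)) I ∞ Φ (Metric.closedBall 0 1) ∧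
    Set.InjOn Φ (Metric.closedBall 0 1) ∧
    (∀ u ∈ Metric.closedBall (0 : EuclideanSpace ℝ (Fin k)) 1, Function.Injective
      (mfderivWithin 𝓘(ℝ, EuclideanSpace ℝ (Fin k)) I Φ (Metric.closedBall 0 1) u)) ∧
    Φ '' Metric.closedBall 0 1 = e ∧
    e ∩ A = Φ '' Metric.sphere 0 1

end Morse

/-- The closed sublevel set `M^a = {x ∈ M : f x ≤ a}`. -/
def sublevel {M : Type*} (f : M → ℝ) (a : ℝ) : Set M := {x | f x ≤ a}

end

open Set Filter Topology MeasureTheory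

/-! ### Smooth dependence of integrals on parameters; Hadamard's lemma. -/

section ParametricIntegral

variable {V : Type} [NormedAddCommGroup V] [NormedSpace ℝ V] [FiniteDimensional ℝ V]

/-! No gradient flow is used. The deformation is assembled from descending homotopies: smooth
families that are the identity at time 1, along which `f` never rises, and whose time-0 map fixes a
prescribed set and strictly lowers `f` at every point it moves. Such homotopies compose, so local
constructions can be superposed without integrating a vector field.

Near `p` the Morse lemma (`exists_morse_chart`) gives `f = c - ‖x‖² + ‖y‖²`. The disk `y = 0`, `‖x‖
≤ √ε` is the cell `e` (`isAttachedCell_of_chart`), and contracting `y` collapses a neighbourhood `C`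
of `e` into `A = M^{c-ε} ∪ e` (`exists_collapse`). The part of the slab `c - ε ≤ f ≤ d` outside `C`
is compact and free of critical points, so each of its points can be pushed down locally
(`exists_push`). At a boundary point `f = 1` is maximal, which allows a descent direction that does
not leave the manifold (`exists_descent_direction`). Finitely many pushes handle the whole compact
set (`exists_isDescendingHomotopy_lt_of_isCompact`).

Collapse followed by push preserves `A`, sends `C` into `A`, and lowers `f` by a uniform amount on
the rest of the slab; finitely many iterations therefore bring `M^d` into `A`
(`IsDescendingHomotopy.exists_mapsTo`).

The Morse lemma rests on Hadamard's lemma applied twice, a smooth square root of symmetric forms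
near the Hessian, obtained from the inverse function theorem, and Sylvester's law. -/

theorem hasFDerivAt_integral_of_contDiff {W : Type} [NormedAddCommGroup W] [NormedSpace ℝ W]
    [CompleteSpace W] {G : V × ℝ → W} (hG : ContDiff ℝ ∞ G) (x₀ : V) :
    HasFDerivAt (fun x => ∫ t in (0 : ℝ)..1, G (x, t))
      (∫ t in (0 : ℝ)..1, (fderiv ℝ G (x₀, t)).comp (ContinuousLinearMap.inl ℝ V ℝ)) x₀ := by
  have hG' : Continuous fun z : V × ℝ =>
      (fderiv ℝ G z).comp (ContinuousLinearMap.inl ℝ V ℝ) :=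
    (hG.continuous_fderiv (by simp)).clm_comp continuous_const
  -- Local compactness of `V` provides a constant dominating the derivative near `x₀`.
  obtain ⟨C, hC⟩ := ((isCompact_closedBall x₀ 1).prod (isCompact_Icc (a := (0 : ℝ)) (b := 1))
    ).exists_bound_of_continuousOn hG'.continuousOn
  refine (intervalIntegral.hasFDerivAt_integral_of_dominated_of_fderiv_le
    (F := fun x t => G (x, t)) (F' := fun x t => (fderiv ℝ G (x, t)).comp
      (ContinuousLinearMap.inl ℝ V ℝ)) (bound := fun _ => C)
    (Metric.closedBall_mem_nhds x₀ one_pos) ?_ ?_ ?_ ?_ ?_ ?_)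
  · exact Eventually.of_forall fun x =>
      (hG.continuous.comp (by fun_prop : Continuous fun t : ℝ => (x, t))).aestronglyMeasurable
  · exact (hG.continuous.comp (by fun_prop : Continuous fun t : ℝ => (x₀, t))).intervalIntegrable
      _ _
  · exact (hG'.comp (by fun_prop : Continuous fun t : ℝ => (x₀, t))).aestronglyMeasurable
  · refine Eventually.of_forall fun t ht x hx => hC (x, t) ⟨hx, ?_⟩
    rw [uIoc_of_le zero_le_one] at ht
    exact ⟨ht.1.le, ht.2⟩
  · simp
  · refine Eventually.of_forall fun t _ x _ => ?_
    have h1 : HasFDerivAt G (fderiv ℝ G (x, t)) (x, t) :=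
      (hG.differentiable (by simp) _).hasFDerivAt
    have h2 : HasFDerivAt (fun y : V => (y, t)) (ContinuousLinearMap.inl ℝ V ℝ) x :=
      hasFDerivAt_prodMk_left x t
    exact h1.comp x h2

/-- The derivative is an integral of the same kind with values in `V →L[ℝ] W`, so the induction on
the order must let `W` vary. -/
theorem contDiff_integral_of_contDiff {W : Type} [NormedAddCommGroup W] [NormedSpace ℝ W]
    [CompleteSpace W] {G : V × ℝ → W} (hG : ContDiff ℝ ∞ G) :
    ContDiff ℝ ∞ (fun x => ∫ t in (0 : ℝ)..1, G (x, t)) := by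
  rw [contDiff_infty]
  intro n
  induction n generalizing W with
  | zero =>
    rw [Nat.cast_zero, contDiff_zero]
    exact intervalIntegral.continuous_parametric_intervalIntegral_of_continuous'
      (f := fun x t => G (x, t)) hG.continuous 0 1
  | succ n ih =>
    rw [Nat.cast_succ, contDiff_succ_iff_hasFDerivAt]
    exact ⟨_, ih ((hG.fderiv_right (m := ∞) (by simp)).clm_comp contDiff_const),
      hasFDerivAt_integral_of_contDiff hG⟩

/-- **Hadamard's lemma**: a smooth function is its value at the origin plus a smooth family of
linear maps applied to the variable. -/
theorem exists_contDiff_eq_add_apply {W : Type} [NormedAddCommGroup W] [NormedSpace ℝ W]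
    [CompleteSpace W] {G : V → W} (hG : ContDiff ℝ ∞ G) :
    ∃ A : V → V →L[ℝ] W, ContDiff ℝ ∞ A ∧ (∀ x, G x = G 0 + A x x) ∧ A 0 = fderiv ℝ G 0 ∧
      fderiv ℝ A 0 = (1 / 2 : ℝ) • fderiv ℝ (fderiv ℝ G) 0 := by
  have hG' : ContDiff ℝ ∞ (fderiv ℝ G) := hG.fderiv_right (m := ∞) (by simp)
  have hK : ContDiff ℝ ∞ fun z : V × ℝ => fderiv ℝ G (z.2 • z.1) :=
    hG'.comp (contDiff_snd.smul contDiff_fst)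
  refine ⟨fun x => ∫ t in (0 : ℝ)..1, fderiv ℝ G (t • x), contDiff_integral_of_contDiff hK,
    fun x => ?_, by simp, ?_⟩
  · have hd : ∀ t : ℝ, HasDerivAt (fun t : ℝ => G (t • x)) (fderiv ℝ G (t • x) x) t := fun t => by
      have h1 := (hG.differentiable (by simp) (t • x)).hasFDerivAt
      have h2 : HasDerivAt (fun t : ℝ => t • x) x t := by
        simpa using (hasDerivAt_id t).smul_const x
      exact h1.comp_hasDerivAt t h2
    have hc : Continuous fun t : ℝ => fderiv ℝ G (t • x) :=
      hG'.continuous.comp (by fun_prop)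
    have := intervalIntegral.integral_eq_sub_of_hasDerivAt (a := 0) (b := 1) (fun t _ => hd t)
      ((hc.clm_apply continuous_const).intervalIntegrable _ _)
    rw [ContinuousLinearMap.intervalIntegral_apply (hc.intervalIntegrable _ _), this]
    simp
  · have := (hasFDerivAt_integral_of_contDiff hK 0).fderiv
    rw [this]
    -- The factor `t` from the chain rule integrates to `1 / 2`.
    have key : ∀ t : ℝ, (fderiv ℝ (fun z : V × ℝ => fderiv ℝ G (z.2 • z.1)) (0, t)).comp
        (ContinuousLinearMap.inl ℝ V ℝ) = t • fderiv ℝ (fderiv ℝ G) 0 := fun t => by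
      have h1 : HasFDerivAt (fun z : V × ℝ => fderiv ℝ G (z.2 • z.1)) _ (0, t) :=
        (hK.differentiable (by simp) (0, t)).hasFDerivAt
      have h2 : HasFDerivAt (fun y : V => (y, t)) (ContinuousLinearMap.inl ℝ V ℝ) 0 :=
        hasFDerivAt_prodMk_left 0 t
      have h3 := h1.comp (0 : V) h2
      have h4 : HasFDerivAt (fderiv ℝ G) (fderiv ℝ (fderiv ℝ G) 0) (t • (0 : V)) := by
        rw [smul_zero]; exact (hG'.differentiable (by simp) 0).hasFDerivAt
      have h5 : HasFDerivAt (fun y : V => t • y) (t • ContinuousLinearMap.id ℝ V) 0 :=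
        (hasFDerivAt_id (0 : V)).const_smul t
      have h6 := h4.comp (0 : V) h5
      rw [h3.unique h6]
      ext; simp
    simp_rw [key]
    rw [intervalIntegral.integral_smul_const, integral_id]
    norm_num

end ParametricIntegral

/-! ### The Morse lemma in a vector space. -/

section MorseLemma

variable {V : Type} [NormedAddCommGroup V] [NormedSpace ℝ V] [FiniteDimensional ℝ V]

/-- A function which is smooth near the origin agrees near the origin with a smooth function. -/
theorem exists_contDiff_eventuallyEq {W : Type} [NormedAddCommGroup W] [NormedSpace ℝ W]
    {F : V → W} {s : Set V} (hs : s ∈ 𝓝 (0 : V)) (hF : ContDiffOn ℝ ∞ F s) :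
    ∃ G : V → W, ContDiff ℝ ∞ G ∧ G =ᶠ[𝓝 0] F := by
  obtain ⟨r, hr, hrs⟩ := Metric.mem_nhds_iff.1 hs
  let b : ContDiffBump (0 : V) := ⟨r / 3, r / 2, by positivity, by linarith⟩
  refine ⟨fun x => b x • F x, contDiff_iff_contDiffAt.2 fun x => ?_, ?_⟩
  · by_cases hx : x ∈ Metric.ball (0 : V) r
    · exact b.contDiffAt.smul (hF.contDiffAt (mem_of_superset (Metric.isOpen_ball.mem_nhds hx) hrs))
    · have hx' : x ∈ (tsupport b)ᶜ := by
        rw [b.tsupport_eq]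
        intro h
        have h' : dist x 0 ≤ r / 2 := h
        exact hx (by rw [Metric.mem_ball]; linarith)
      have : (fun x => b x • F x) =ᶠ[𝓝 x] fun _ => 0 := by
        filter_upwards [(isClosed_tsupport b).isOpen_compl.mem_nhds hx'] with y hy
        rw [image_eq_zero_of_notMem_tsupport hy, zero_smul]
      exact contDiffAt_const.congr_of_eventuallyEq this
  · filter_upwards [b.eventuallyEq_one] with x hx
    simp [hx]

theorem contDiff_flip :
    ContDiff ℝ ∞ fun S : V →L[ℝ] V →L[ℝ] ℝ => S.flip := by
  refine contDiff_clm_apply_iff.2 fun v => contDiff_clm_apply_iff.2 fun w => ?_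
  exact (contDiff_id.clm_apply contDiff_const).clm_apply contDiff_const

/-- At `S = J` both terms of the product rule equal the increment, so the derivative is
multiplication by 2. Its invertibility is what yields square roots near `J`. -/
theorem hasFDerivAt_comp_comp_self {X W : Type} [NormedAddCommGroup X] [NormedSpace ℝ X] [NormedAddCommGroup W]
    [NormedSpace ℝ W]
    (J : X ≃L[ℝ] W) :
    HasFDerivAt (fun S : X →L[ℝ] W => (S.comp (J.symm : W →L[ℝ] X)).comp S)
      ((ContinuousLinearEquiv.smulLeft (Units.mk0 (2 : ℝ) two_ne_zero) :
        (X →L[ℝ] W) ≃L[ℝ] (X →L[ℝ] W)) : (X →L[ℝ] W) →L[ℝ] (X →L[ℝ] W)) (J : X →L[ℝ] W) := by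
  have h1 := (hasFDerivAt_id (𝕜 := ℝ) (J : X →L[ℝ] W)).clm_comp
    (hasFDerivAt_const (J.symm : W →L[ℝ] X) (J : X →L[ℝ] W))
  refine (h1.clm_comp (hasFDerivAt_id (𝕜 := ℝ) (J : X →L[ℝ] W))).congr_fderiv ?_
  ext S v
  simp [Units.smul_def, two_smul]

/-- **Inverse function theorem** for smooth maps, with a smooth inverse on the whole target. -/
theorem exists_openPartialHomeomorph_of_contDiffOn {X Y : Type} [NormedAddCommGroup X]
    [NormedSpace ℝ X] [CompleteSpace X] [NormedAddCommGroup Y] [NormedSpace ℝ Y] {f : X → Y}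
    {s : Set X} {a : X} (hs : s ∈ 𝓝 a) (hf : ContDiffOn ℝ ∞ f s) {f' : X ≃L[ℝ] Y}
    (hf' : HasFDerivAt f (f' : X →L[ℝ] Y) a) :
    ∃ P : OpenPartialHomeomorph X Y, (∀ x, P x = f x) ∧ a ∈ P.source ∧ P.source ⊆ s ∧
      ContDiffOn ℝ ∞ P P.source ∧ ContDiffOn ℝ ∞ P.symm P.target := by
  have hfa : ContDiffAt ℝ ∞ f a := hf.contDiffAt hs
  -- Restricting to points where the derivative stays invertible makes the inverse smooth on the
  -- whole target, not only at `f a`.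
  have hinv : ∀ᶠ x in 𝓝 a, fderiv ℝ f x ∈ range ((↑) : (X ≃L[ℝ] Y) → X →L[ℝ] Y) := by
    have h1 : ContinuousAt (fderiv ℝ f) a :=
      (hfa.fderiv_right (m := 0) (by simp)).continuousAt
    refine h1.eventually ?_
    rw [hf'.fderiv]
    exact f'.nhds
  obtain ⟨u, hu, huo, hau⟩ := mem_nhds_iff.1 (inter_mem hs hinv)
  let P₀ := hfa.toOpenPartialHomeomorph f hf' (by simp)
  let P := P₀.restrOpen u huo
  have hsrc : P.source = P₀.source ∩ u := rfl
  have hat : ∀ x ∈ P.source, ContDiffAt ℝ ∞ f x := fun x hx =>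
    hf.contDiffAt (mem_of_superset (huo.mem_nhds (hsrc ▸ hx).2) fun y hy => (hu hy).1)
  refine ⟨P, fun x => rfl, ⟨hfa.mem_toOpenPartialHomeomorph_source hf' (by simp), hau⟩,
    fun x hx => (hu (hsrc ▸ hx).2).1, fun x hx => (hat x hx).contDiffWithinAt, fun y hy => ?_⟩
  have hys : P.symm y ∈ P.source := P.map_target hy
  obtain ⟨e, he⟩ := (hu (hsrc ▸ hys).2).2
  refine (P.contDiffAt_symm (f₀' := e) hy ?_ (hat _ hys)).contDiffWithinAt
  rw [he]
  exact ((hat _ hys).differentiableAt (by simp)).hasFDerivAt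

/-- Second-order Hadamard lemma at a critical point. -/
theorem exists_contDiff_symm_quadratic {F : V → ℝ} (hF : ContDiff ℝ ∞ F)
    (h0 : fderiv ℝ F 0 = 0) :
    ∃ B : V → V →L[ℝ] V →L[ℝ] ℝ, ContDiff ℝ ∞ B ∧ (∀ x, F x = F 0 + 1 / 2 * B x x x) ∧
      (∀ x v w, B x v w = B x w v) ∧ B 0 = fderiv ℝ (fderiv ℝ F) 0 := by
  obtain ⟨A, hA, hFA, hA0, hA1⟩ := exists_contDiff_eq_add_apply hF
  obtain ⟨B, hB, hAB, hB0, -⟩ := exists_contDiff_eq_add_apply hA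
  -- Symmetrizing doubles the form, whence the `1 / 2`. At the origin `B 0` is half the second
  -- derivative, whose symmetry makes the sum the Hessian itself.
  refine ⟨fun x => B x + (B x).flip, ?_, fun x => ?_, fun x v w => ?_, ?_⟩
  · exact hB.add (contDiff_flip.comp hB)
  · rw [hFA x, hAB x, hA0, h0]
    simp only [add_apply, zero_apply, ContinuousLinearMap.flip_apply]
    ring
  · simp only [add_apply, ContinuousLinearMap.flip_apply]
    ring
  · have hsymm : IsSymmSndFDerivAt ℝ F 0 :=
      hF.contDiffAt.isSymmSndFDerivAt (by rw [minSmoothness_of_isRCLikeNormedField]; exact WithTop.coe_le_coe.2 le_top)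
    simp only [hB0, hA1]
    ext v w
    simp only [add_apply, ContinuousLinearMap.flip_apply, smul_apply,
      smul_eq_mul, hsymm w v]
    ring

/-- Near a nondegenerate symmetric form `J`, symmetric forms have a smooth square root
with respect to `J`. -/
theorem exists_sqrt_of_nondegenerate (J : V ≃L[ℝ] V →L[ℝ] ℝ) (hJ : ∀ v w, J v w = J w v) :
    ∃ (R : (V →L[ℝ] V →L[ℝ] ℝ) → (V →L[ℝ] V →L[ℝ] ℝ)),
      R J = J ∧ ∃ u ∈ 𝓝 (J : V →L[ℝ] V →L[ℝ] ℝ), ContDiffOn ℝ ∞ R u ∧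
      ∀ B ∈ u, (∀ v w, B v w = B w v) →
        ∀ v, J (J.symm (R B v)) (J.symm (R B v)) = B v v := by
  let Θ : (V →L[ℝ] V →L[ℝ] ℝ) → (V →L[ℝ] V →L[ℝ] ℝ) := fun S =>
    (S.comp (J.symm : (V →L[ℝ] ℝ) →L[ℝ] V)).comp S
  have hΘ : ContDiff ℝ ∞ Θ := (contDiff_id.clm_comp contDiff_const).clm_comp contDiff_id
  have hΘJ : Θ J = J := by ext; simp [Θ]
  obtain ⟨P, hP, hJs, -, -, hPt⟩ := exists_openPartialHomeomorph_of_contDiffOn univ_mem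
    hΘ.contDiffOn (hasFDerivAt_comp_comp_self J)
  have hJt : (J : V →L[ℝ] V →L[ℝ] ℝ) ∈ P.target := by
    have := P.map_source hJs; rwa [hP, hΘJ] at this
  have hRJ : P.symm J = J := by
    have := P.left_inv hJs; rwa [hP, hΘJ] at this
  have hR : ContDiffAt ℝ ∞ P.symm J := hPt.contDiffAt (P.open_target.mem_nhds hJt)
  have hflip : (J : V →L[ℝ] V →L[ℝ] ℝ).flip = J := by ext v w; simp [hJ v w]
  have hc : Tendsto (fun B => (P.symm B).flip) (𝓝 (J : V →L[ℝ] V →L[ℝ] ℝ))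
      (𝓝 (J : V →L[ℝ] V →L[ℝ] ℝ)) := by
    have h1 := (contDiff_flip.continuous.tendsto (P.symm J)).comp hR.continuousAt.tendsto
    rwa [hRJ, hflip] at h1
  -- The second condition keeps the transpose of the root in `P.source`, where `Θ` is injective.
  refine ⟨P.symm, hRJ, _, inter_mem (P.open_target.mem_nhds hJt)
    (hc.eventually (P.open_source.mem_nhds hJs)), hPt.mono inter_subset_left, ?_⟩
  rintro B ⟨hBt, hBs⟩ hB v
  have hS : Θ (P.symm B) = B := (hP _).symm.trans (P.right_inv hBt)
  have hSv : ∀ v w, P.symm B (J.symm (P.symm B v)) w = B v w := fun v w => by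
    conv_rhs => rw [← hS]
    rfl
  have hJsymm : ∀ φ ψ : V →L[ℝ] ℝ, φ (J.symm ψ) = ψ (J.symm φ) := fun φ ψ => by
    conv_lhs => rw [← J.apply_symm_apply φ]
    rw [hJ, J.apply_symm_apply]
  -- As `J` is symmetric, `Θ` commutes with transposition, so the transposed root is also a root of
  -- the symmetric form `B`; injectivity forces the root to be symmetric.
  have hfl : (P.symm B).flip = P.symm B := by
    refine P.injOn hBs (P.map_target hBt) ?_
    rw [hP, hP, hS]
    ext v w
    have h1 : Θ (P.symm B).flip v w =
      (P.symm B) w (J.symm ((P.symm B).flip v)) := rfl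
    rw [h1, hJsymm]
    have h2 : ((P.symm B).flip v) (J.symm (P.symm B w)) =
      P.symm B (J.symm (P.symm B w)) v := rfl
    rw [h2, hSv, hB]
  rw [J.apply_symm_apply]
  have h3 : P.symm B v (J.symm (P.symm B v)) = (P.symm B).flip (J.symm (P.symm B v)) v := rfl
  rw [h3, hfl, hSv]

/-- **Morse lemma**: near a nondegenerate critical point, a smooth function is its Hessian in
suitable coordinates. -/
theorem exists_morse_coordinates {F : V → ℝ} {s : Set V} (hs : s ∈ 𝓝 (0 : V))
    (hF : ContDiffOn ℝ ∞ F s) (h0 : fderiv ℝ F 0 = 0) (J : V ≃L[ℝ] V →L[ℝ] ℝ)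
    (hJ : fderiv ℝ (fderiv ℝ F) 0 = J) :
    ∃ T : OpenPartialHomeomorph V V, 0 ∈ T.source ∧ T 0 = 0 ∧ T.source ⊆ s ∧
      ContDiffOn ℝ ∞ T T.source ∧ ContDiffOn ℝ ∞ T.symm T.target ∧
      ∀ x ∈ T.source, F x = F 0 + 1 / 2 * J (T x) (T x) := by
  obtain ⟨G, hG, hGF⟩ := exists_contDiff_eventuallyEq hs hF
  obtain ⟨B, hB, hGB, hBs, hB0⟩ := exists_contDiff_symm_quadratic hG (hGF.fderiv_eq.trans h0)
  rw [hGF.fderiv.fderiv_eq, hJ] at hB0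
  obtain ⟨R, hRJ, u, hu, hR, hRB⟩ := exists_sqrt_of_nondegenerate J
    (fun v w => by simpa [hB0] using hBs 0 v w)
  rw [← hB0] at hu
  have hu' : B ⁻¹' u ∈ 𝓝 (0 : V) := hB.continuous.continuousAt.preimage_mem_nhds hu
  have hRc : ContDiffOn ℝ ∞ (fun x => R (B x)) (B ⁻¹' u) := hR.comp hB.contDiffOn fun x hx => hx
  -- By the defining property of `R`, evaluating `J` twice on this vector gives `B x x x`. Its
  -- derivative at 0 is the identity because `R J = J`.
  have hT : ContDiffOn ℝ ∞ (fun x => J.symm (R (B x) x)) (B ⁻¹' u) :=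
    J.symm.contDiff.comp_contDiffOn (hRc.clm_apply contDiffOn_id)
  have hTd : HasFDerivAt (fun x => J.symm (R (B x) x))
      ((ContinuousLinearEquiv.refl ℝ V : V ≃L[ℝ] V) : V →L[ℝ] V) 0 := by
    have h1 : HasFDerivAt (fun x => R (B x)) _ (0 : V) :=
      ((hRc.contDiffAt hu').differentiableAt (by simp)).hasFDerivAt
    have h2 := J.symm.hasFDerivAt.comp (0 : V) (h1.clm_apply (hasFDerivAt_id (𝕜 := ℝ) (0 : V)))
    refine h2.congr_fderiv ?_
    ext v
    simp [hB0, hRJ]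
  obtain ⟨P, hP, hPs, hPsub, hPc, hPt⟩ := exists_openPartialHomeomorph_of_contDiffOn
    (inter_mem (inter_mem hu' hs) hGF) (hT.mono (inter_subset_left.trans inter_subset_left)) hTd
  refine ⟨P, hPs, by simp [hP], fun x hx => (hPsub hx).1.2, hPc, hPt, fun x hx => ?_⟩
  obtain ⟨⟨hx1, -⟩, hx2⟩ := hPsub hx
  have hx2' : G x = F x := hx2
  rw [hP, hRB (B x) hx1 (hBs x), ← hx2', ← hGF.eq_of_nhds, ← hGB]

end MorseLemma

/-! ### Diagonalization of the Hessian. -/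

section Sylvester

/-- **Sylvester's law of inertia**, with the negative and positive directions separated. -/
theorem exists_linearEquiv_neg_add_sq {E : Type*} [AddCommGroup E] [Module ℝ E]
    [FiniteDimensional ℝ E] (Q : QuadraticForm ℝ E)
    (hQ : (QuadraticMap.associated (R := ℝ) Q).SeparatingLeft) :
    ∃ m : ℕ, ∃ L : (EuclideanSpace ℝ (Fin (sigNeg Q)) × EuclideanSpace ℝ (Fin m)) ≃ₗ[ℝ] E,
      ∀ z, Q (L z) = -‖z.1‖ ^ 2 + ‖z.2‖ ^ 2 := by
  obtain ⟨w, hw, hQw⟩ := QuadraticForm.equivalent_one_neg_one_weighted_sum_squared Q hQ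
  have hk := QuadraticForm.sigNeg_of_equiv_weightedSumSquares hQw
  obtain ⟨e⟩ := hQw
  let N := Module.finrank ℝ E
  -- Indices of weight `-1` are listed first; there are `sigNeg Q` of them.
  let σ₁ : Fin (sigNeg Q) ≃ {i : Fin N // w i < 0} :=
    (Finite.equivFinOfCardEq (by rw [hk]; rfl)).symm
  let σ₂ : Fin (Nat.card {i : Fin N // ¬ w i < 0}) ≃ {i : Fin N // ¬ w i < 0} :=
    (Finite.equivFin _).symm
  let σ : Fin (sigNeg Q) ⊕ Fin (Nat.card {i : Fin N // ¬ w i < 0}) ≃ Fin N :=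
    (σ₁.sumCongr σ₂).trans (Equiv.sumCompl fun i => w i < 0)
  let L := (((WithLp.linearEquiv 2 ℝ (Fin (sigNeg Q) → ℝ)).prodCongr
    (WithLp.linearEquiv 2 ℝ (Fin (Nat.card {i : Fin N // ¬ w i < 0}) → ℝ))).trans
      (LinearEquiv.sumArrowLequivProdArrow _ _ ℝ ℝ).symm).trans
      ((LinearEquiv.funCongrLeft ℝ ℝ σ).symm.trans e.symm.toLinearEquiv)
  refine ⟨_, L, fun z => ?_⟩
  have h1 : Q (L z) = QuadraticMap.weightedSumSquares ℝ w (e (L z)) := (e.map_app _).symm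
  have h2 : ∀ j, (e (L z)) (σ j) = Sum.elim z.1 z.2 j := fun j => by
    have : e (L z) = fun i => Sum.elim z.1 z.2 (σ.symm i) := by
      simp only [L, LinearEquiv.trans_apply]
      erw [e.apply_symm_apply]
      rfl
    rw [this]
    exact congrArg _ (σ.symm_apply_apply j)
  have hw1 : ∀ i, w (σ (Sum.inl i)) = -1 := fun i => by
    have : w (σ (Sum.inl i)) < 0 := (σ₁ i).2
    rcases hw (σ (Sum.inl i)) with h | h
    · exact h
    · linarith
  have hw2 : ∀ i, w (σ (Sum.inr i)) = 1 := fun i => by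
    have : ¬ w (σ (Sum.inr i)) < 0 := (σ₂ i).2
    rcases hw (σ (Sum.inr i)) with h | h
    · linarith
    · exact h
  rw [h1, QuadraticMap.weightedSumSquares_apply, ← σ.sum_comp, Fintype.sum_sum_type,
    EuclideanSpace.real_norm_sq_eq, EuclideanSpace.real_norm_sq_eq]
  simp [h2, hw1, hw2, sq]

end Sylvester

/-! ### Morse charts on a manifold. -/

section MorseChart

variable {E : Type*} [NormedAddCommGroup E] [NormedSpace ℝ E]

/-- **Morse lemma** at a point, in linear coordinates given by `L`. -/
theorem exists_morse_coordinates_of_equiv {V : Type} [NormedAddCommGroup V] [NormedSpace ℝ V]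
    [FiniteDimensional ℝ V] {F : E → ℝ} {s : Set E} {a : E} (hs : s ∈ 𝓝 a)
    (hF : ContDiffOn ℝ ∞ F s) (h0 : fderiv ℝ F a = 0)
    (hnd : (fderiv ℝ (fderiv ℝ F) a).toLinearMap₁₂.Nondegenerate) (L : V ≃L[ℝ] E) :
    ∃ P : OpenPartialHomeomorph E V,
      a ∈ P.source ∧ P a = 0 ∧ P.source ⊆ s ∧ ContDiffOn ℝ ∞ P P.source ∧
      ContDiffOn ℝ ∞ P.symm P.target ∧
      ∀ x ∈ P.source,
        F x = F a + 1 / 2 * fderiv ℝ (fderiv ℝ F) a (L (P x)) (L (P x)) := by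
  generalize hD : fderiv ℝ (fderiv ℝ F) a = D at hnd ⊢
  let B : LinearMap.BilinForm ℝ V :=
    D.toLinearMap₁₂.compl₁₂ L.toLinearMap L.toLinearMap
  have hB : ∀ v w, B v w = D (L v) (L w) := fun _ _ => rfl
  have hBnd : B.Nondegenerate := by
    refine ⟨fun v hv => ?_, fun v hv => ?_⟩
    · refine L.map_eq_zero_iff.1 (hnd.1 _ fun w => ?_)
      have := hv (L.symm w)
      rwa [hB, L.apply_symm_apply] at this
    · refine L.map_eq_zero_iff.1 (hnd.2 _ fun w => ?_)
      have := hv (L.symm w)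
      rwa [hB, L.apply_symm_apply] at this
  let J : V ≃L[ℝ] V →L[ℝ] ℝ :=
    ((B.toDual hBnd).trans LinearMap.toContinuousLinearMap).toContinuousLinearEquiv
  have hJ : ∀ v w, J v w = D (L v) (L w) := fun _ _ => rfl
  have hfd : fderiv ℝ (fun z => F (a + L z)) = fun z => (fderiv ℝ F (a + L z)).comp
      (L : V →L[ℝ] E) := by
    funext z
    have h1 := L.comp_right_fderiv (f := fun y => F (a + y)) (x := z)
    rw [fderiv_comp_add_left] at h1
    exact h1
  have hs' : (fun z => a + L z) ⁻¹' s ∈ 𝓝 (0 : V) := by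
    refine ContinuousAt.preimage_mem_nhds (by fun_prop) ?_
    rwa [map_zero, add_zero]
  have hA : ContDiff ℝ ∞ fun z => a + L z := contDiff_const.add L.contDiff
  have hJD : fderiv ℝ (fderiv ℝ fun z => F (a + L z)) 0 = J := by
    have h1 : HasFDerivAt (fderiv ℝ F) D (a + L 0) := by
      rw [map_zero, add_zero, ← hD]
      exact (((hF.contDiffAt hs).fderiv_right (m := 1) (by norm_cast)).differentiableAt
        (by simp)).hasFDerivAt
    have h2 : HasFDerivAt (fun z => a + L z) (L : V →L[ℝ] E) 0 := L.hasFDerivAt.const_add a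
    have h3 := (h1.comp 0 h2).clm_comp (hasFDerivAt_const (L : V →L[ℝ] E) 0)
    rw [hfd]
    refine h3.fderiv.trans ?_
    ext v w
    simp [hJ]
  obtain ⟨T, hT0, hTz, hTs, hTc, hTc', hTF⟩ := exists_morse_coordinates
    (F := fun z => F (a + L z)) hs' (hF.comp hA.contDiffOn fun x hx => hx)
    (by rw [hfd]; simp only [map_zero, add_zero, h0, ContinuousLinearMap.zero_comp]) J hJD
  let A : E ≃ₜ V := (Homeomorph.addLeft (-a)).trans L.symm.toHomeomorph
  have hA1 : ∀ x, A x = L.symm (-a + x) := fun _ => rfl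
  have hLA : ∀ x, a + L (A x) = x := fun x => by rw [hA1]; simp
  have hA2 : ∀ z, A.symm z = a + L z := fun z => by
    rw [Homeomorph.symm_apply_eq, hA1]; simp
  have hAc : ContDiff ℝ ∞ A := L.symm.contDiff.comp (contDiff_const.add contDiff_id)
  have hAc' : ContDiff ℝ ∞ A.symm := by
    rw [funext hA2]; exact hA
  have hAa : A a = 0 := by rw [hA1]; simp
  refine ⟨A.transOpenPartialHomeomorph T, ?_, ?_, fun x hx => ?_, ?_, ?_, fun x hx => ?_⟩
  · change A a ∈ T.source
    rwa [hAa]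
  · change T (A a) = 0
    rw [hAa, hTz]
  · have h1 : a + L (A x) ∈ s := hTs hx
    rwa [hLA] at h1
  · exact hTc.comp hAc.contDiffOn fun x hx => hx
  · exact hAc'.comp_contDiffOn hTc'
  · have h1 := hTF (A x) hx
    simp only [hLA, map_zero, add_zero, hJ] at h1
    exact h1

/-- **Morse lemma** at a point, in coordinates for which the Hessian is diagonal. -/
theorem exists_morse_coordinates_at [FiniteDimensional ℝ E] {F : E → ℝ} {s : Set E} {a : E} (hs : s ∈ 𝓝 a)
    (hF : ContDiffOn ℝ ∞ F s) (h0 : fderiv ℝ F a = 0) {k : ℕ}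
    (hnd : (fderiv ℝ (fderiv ℝ F) a).toLinearMap₁₂.Nondegenerate)
    (hk : sigNeg (LinearMap.BilinMap.toQuadraticMap
      (fderiv ℝ (fderiv ℝ F) a).toLinearMap₁₂) = k) :
    ∃ (m : ℕ) (P : OpenPartialHomeomorph E
        (EuclideanSpace ℝ (Fin k) × EuclideanSpace ℝ (Fin m))),
      a ∈ P.source ∧ P a = 0 ∧ P.source ⊆ s ∧ ContDiffOn ℝ ∞ P P.source ∧
      ContDiffOn ℝ ∞ P.symm P.target ∧
      ∀ x ∈ P.source, F x = F a - ‖(P x).1‖ ^ 2 + ‖(P x).2‖ ^ 2 := by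
  have hDs : IsSymmSndFDerivAt ℝ F a := (hF.contDiffAt hs).isSymmSndFDerivAt
    (by rw [minSmoothness_of_isRCLikeNormedField]; exact WithTop.coe_le_coe.2 le_top)
  obtain ⟨m, L₀, hL₀⟩ : ∃ m : ℕ, ∃ L : (EuclideanSpace ℝ (Fin k) ×
      EuclideanSpace ℝ (Fin m)) ≃ₗ[ℝ] E,
      ∀ z, fderiv ℝ (fderiv ℝ F) a (L z) (L z) = -‖z.1‖ ^ 2 + ‖z.2‖ ^ 2 := by
    have h2 : QuadraticMap.associated (R := ℝ) (LinearMap.BilinMap.toQuadraticMap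
        (fderiv ℝ (fderiv ℝ F) a).toLinearMap₁₂) = (fderiv ℝ (fderiv ℝ F) a).toLinearMap₁₂ :=
      QuadraticMap.associated_left_inverse ℝ fun v w => hDs v w
    have h1 := exists_linearEquiv_neg_add_sq (LinearMap.BilinMap.toQuadraticMap
      (fderiv ℝ (fderiv ℝ F) a).toLinearMap₁₂) (by rw [h2]; exact hnd.1)
    rw [hk] at h1
    exact h1
  -- Scaling the diagonalizing basis by `√2` absorbs the factor `1 / 2`.
  have h2 : (√2 : ℝ) * √2 = 2 := Real.mul_self_sqrt (by norm_num)
  obtain ⟨P, hPa, hP0, hPs, hPc, hPc', hPF⟩ := exists_morse_coordinates_of_equiv hs hF h0 hnd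
    (L₀.trans (LinearEquiv.smulOfNeZero ℝ E (√2) (by positivity))).toContinuousLinearEquiv
  refine ⟨m, P, hPa, hP0, hPs, hPc, hPc', fun x hx => ?_⟩
  have h1 : ∀ z, (L₀.trans (LinearEquiv.smulOfNeZero ℝ E (√2)
    (by positivity))).toContinuousLinearEquiv z = √2 • L₀ z := fun _ => rfl
  rw [hPF x hx, h1, map_smul, map_smul, smul_apply, smul_eq_mul, smul_eq_mul, ← mul_assoc √2,
    h2, hL₀]
  ring

variable {H : Type*} [TopologicalSpace H] {I : ModelWithCorners ℝ E H}
  {M : Type*} [TopologicalSpace M] [ChartedSpace H M] [IsManifold I ∞ M]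

/-- **Morse lemma** at an interior point of a manifold. -/
theorem exists_morse_chart [FiniteDimensional ℝ E] {f : M → ℝ}
    (hf : ContMDiff I 𝓘(ℝ, ℝ) ∞ f) {p : M}
    (hpi : I.IsInteriorPoint p) (hp : IsCriticalPt I f p)
    (hnd : (chartHessian I f p).Nondegenerate) :
    ∃ (m : ℕ) (θ : M → EuclideanSpace ℝ (Fin (morseIndex I f p)) × EuclideanSpace ℝ (Fin m))
      (ψ : EuclideanSpace ℝ (Fin (morseIndex I f p)) × EuclideanSpace ℝ (Fin m) → M) (r : ℝ),
      0 < r ∧ ψ 0 = p ∧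
      ContMDiffOn 𝓘(ℝ, EuclideanSpace ℝ (Fin (morseIndex I f p)) × EuclideanSpace ℝ (Fin m)) I ∞
        ψ (Metric.ball 0 r) ∧
      (∀ z ∈ Metric.ball 0 r, θ (ψ z) = z) ∧
      IsOpen (ψ '' Metric.ball 0 r) ∧
      ContMDiffOn I 𝓘(ℝ, EuclideanSpace ℝ (Fin (morseIndex I f p)) × EuclideanSpace ℝ (Fin m)) ∞
        θ (ψ '' Metric.ball 0 r) ∧
      ∀ z ∈ Metric.ball 0 r, f (ψ z) = f p - ‖z.1‖ ^ 2 + ‖z.2‖ ^ 2 := by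
  set φ := extChartAt I p with hφ
  have hR : range I ∈ 𝓝 (φ p) := mem_interior_iff_mem_nhds.1 hpi
  have hs : φ.target ∈ 𝓝 (φ p) :=
    mem_interior_iff_mem_nhds.1 (ModelWithCorners.isInteriorPoint_iff.1 hpi)
  have hF : ContDiffOn ℝ ∞ (f ∘ φ.symm) φ.target := by
    rw [← contMDiffOn_iff_contDiffOn]
    exact hf.comp_contMDiffOn (contMDiffOn_extChartAt_symm p)
  have h0 : fderiv ℝ (f ∘ φ.symm) (φ p) = 0 := by
    have h1 : mfderiv I 𝓘(ℝ, ℝ) f p = 0 := hp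
    rw [(hf.mdifferentiable (by simp) p).mfderiv, fderivWithin_of_mem_nhds hR] at h1
    exact h1
  have hH : chartHessian I f p =
      (fderiv ℝ (fderiv ℝ (f ∘ φ.symm)) (φ p)).toLinearMap₁₂ := by
    have h1 : fderivWithin ℝ (f ∘ φ.symm) (range I) =ᶠ[𝓝 (φ p)] fderiv ℝ (f ∘ φ.symm) := by
      filter_upwards [eventually_mem_nhds_iff.2 hR] with x hx
      exact fderivWithin_of_mem_nhds hx
    unfold chartHessian
    rw [fderivWithin_of_mem_nhds hR, h1.fderiv_eq]
  obtain ⟨m, P, hPa, hP0, hPs, hPc, hPc', hPF⟩ := exists_morse_coordinates_at hs hF h0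
    (hH ▸ hnd) (k := morseIndex I f p) (by rw [morseIndex, hH])
  obtain ⟨r, hr, hrP⟩ := Metric.mem_nhds_iff.1
    (P.open_target.mem_nhds (hP0 ▸ P.map_source hPa : (0 : _ × _) ∈ P.target))
  have hψs : ∀ z ∈ Metric.ball 0 r, P.symm z ∈ φ.target := fun z hz =>
    hPs (P.map_target (hrP hz))
  have himg : φ.symm ∘ P.symm '' Metric.ball 0 r =
      φ.source ∩ φ ⁻¹' (P.symm '' Metric.ball 0 r) := by
    ext x
    constructor
    · rintro ⟨z, hz, rfl⟩
      refine ⟨φ.map_target (hψs z hz), z, hz, ?_⟩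
      exact (φ.right_inv (hψs z hz)).symm
    · rintro ⟨hx, z, hz, hzx⟩
      exact ⟨z, hz, by rw [Function.comp_apply, hzx, φ.left_inv hx]⟩
  have hP0' : P.symm 0 = φ p := by rw [← hP0, P.left_inv hPa]
  refine ⟨m, P ∘ φ, φ.symm ∘ P.symm, r, hr, ?_, ?_, fun z hz => ?_, ?_, ?_, fun z hz => ?_⟩
  · rw [Function.comp_apply, hP0', φ.left_inv (mem_extChartAt_source p)]
  · refine (contMDiffOn_extChartAt_symm p).comp
      (contMDiffOn_iff_contDiffOn.2 (hPc'.mono hrP)) hψs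
  · simp only [Function.comp_apply]
    rw [φ.right_inv (hψs z hz), P.right_inv (hrP hz)]
  · rw [himg]
    exact isOpen_extChartAt_preimage' p
      (P.symm.isOpen_image_of_subset_source Metric.isOpen_ball hrP)
  · rw [himg]
    refine (contMDiffOn_iff_contDiffOn.2 hPc).comp
      ((contMDiffOn_extChartAt (x := p)).mono fun x hx => ?_) ?_
    · rw [← extChartAt_source I]; exact hx.1
    · rintro x ⟨-, z, hz, hzx⟩
      rw [mem_preimage, ← hzx]
      exact P.map_target (hrP hz)
  · have h1 := hPF _ (P.map_target (hrP hz))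
    rw [P.right_inv (hrP hz)] at h1
    simpa [φ.left_inv (mem_extChartAt_source p)] using h1

end MorseChart

/-! ### The calculus of descending homotopies. -/

section DescendingHomotopy

variable {E : Type*} [NormedAddCommGroup E] [NormedSpace ℝ E]
  {H : Type*} [TopologicalSpace H] (I : ModelWithCorners ℝ E H)
  {M : Type*} [TopologicalSpace M] [ChartedSpace H M]

/-- A smooth homotopy, from a map `h (0, ·)` to the identity `h (1, ·)`, along which `f` does not
increase, and such that `h (0, ·)` fixes the points of `e` and strictly decreases `f` at every
point that it moves. -/
structure IsDescendingHomotopy (f : M → ℝ) (e : Set M) (h : ℝ × M → M) : Prop where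
  smooth : ContMDiff (𝓘(ℝ, ℝ).prod I) I ∞ h
  one : ∀ x, h (1, x) = x
  le : ∀ t x, f (h (t, x)) ≤ f x
  fix : ∀ x ∈ e, h (0, x) = x
  lt : ∀ x, h (0, x) = x ∨ f (h (0, x)) < f x

variable {I} {f : M → ℝ} {e : Set M}

theorem isDescendingHomotopy_snd : IsDescendingHomotopy I f e Prod.snd :=
  ⟨contMDiff_snd, fun _ => rfl, fun _ _ => le_rfl, fun _ _ => rfl, fun _ => Or.inl rfl⟩

theorem IsDescendingHomotopy.mono {h : ℝ × M → M} {e' : Set M} (he : e' ⊆ e)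
    (hh : IsDescendingHomotopy I f e h) : IsDescendingHomotopy I f e' h :=
  ⟨hh.smooth, hh.one, hh.le, fun x hx => hh.fix x (he hx), hh.lt⟩

theorem IsDescendingHomotopy.comp {h₁ h₂ : ℝ × M → M} (hh₁ : IsDescendingHomotopy I f e h₁)
    (hh₂ : IsDescendingHomotopy I f e h₂) :
    IsDescendingHomotopy I f e fun z => h₁ (z.1, h₂ z) where
  smooth := hh₁.smooth.comp (contMDiff_fst.prodMk hh₂.smooth)
  one x := by simp [hh₁.one, hh₂.one]
  le t x := (hh₁.le t _).trans (hh₂.le t x)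
  fix x hx := by simp [hh₂.fix x hx, hh₁.fix x hx]
  lt x := by
    rcases hh₂.lt x with h | h
    · simpa [h] using hh₁.lt x
    · exact Or.inr ((hh₁.le 0 _).trans_lt h)

/-- This is the purpose of the alternative in `lt`: `h₂` either already lowers `f` at `x`, or leaves
`x` in place for `h₁` to act on. It cannot carry `x` along a level set to a point where `h₁` is not
strict. -/
theorem IsDescendingHomotopy.comp_lt {h₁ h₂ : ℝ × M → M} (hh₁ : IsDescendingHomotopy I f e h₁)
    (hh₂ : IsDescendingHomotopy I f e h₂) {x : M}
    (hx : f (h₁ (0, x)) < f x ∨ f (h₂ (0, x)) < f x) : f (h₁ (0, h₂ (0, x))) < f x := by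
  rcases hh₂.lt x with h | h
  · rcases hx with hx | hx
    · rwa [h]
    · rw [h] at hx; exact absurd hx (lt_irrefl _)
  · exact (hh₁.le 0 _).trans_lt h

/-- A map which is the projection outside of a closed set and smooth near that set is smooth. -/
theorem contMDiff_of_eq_snd {U K : Set M} (hU : IsOpen U) (hK : IsClosed K) (hKU : K ⊆ U)
    {h : ℝ × M → M} (hs : ContMDiffOn (𝓘(ℝ, ℝ).prod I) I ∞ h (univ ×ˢ U))
    (hid : ∀ t, ∀ x ∉ K, h (t, x) = x) : ContMDiff (𝓘(ℝ, ℝ).prod I) I ∞ h := by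
  rintro ⟨t, x⟩
  by_cases hx : x ∈ U
  · exact hs.contMDiffAt ((isOpen_univ.prod hU).mem_nhds ⟨mem_univ _, hx⟩)
  · have hx' : x ∉ K := fun h' => hx (hKU h')
    refine (contMDiff_snd.contMDiffAt (x := (t, x))).congr_of_eventuallyEq ?_
    filter_upwards [(isOpen_univ.prod hK.isOpen_compl).mem_nhds
      (show (t, x) ∈ univ ×ˢ Kᶜ from ⟨mem_univ _, hx'⟩)] with z hz
    exact hid z.1 z.2 hz.2

/-- A homotopy supported in a coordinate patch `U`, given by a formula `G` in coordinates. -/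
theorem exists_contMDiff_of_coordinates {E' : Type*} [NormedAddCommGroup E'] [NormedSpace ℝ E']
    {U K : Set M} (hU : IsOpen U) (hK : IsClosed K) (hKU : K ⊆ U) {φ : M → E'} {σ : E' → M}
    {T : Set E'} (hφ : ContMDiffOn I 𝓘(ℝ, E') ∞ φ U) (hσ : ContMDiffOn 𝓘(ℝ, E') I ∞ σ T)
    (hσφ : ∀ x ∈ U, σ (φ x) = x) {G : ℝ × E' → E'} (hG : ContDiff ℝ ∞ G)
    (hGT : ∀ t, ∀ x ∈ U, G (t, φ x) ∈ T) (hGK : ∀ t, ∀ x ∈ U, x ∉ K → G (t, φ x) = φ x) :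
    ∃ h : ℝ × M → M, ContMDiff (𝓘(ℝ, ℝ).prod I) I ∞ h ∧
      (∀ t, ∀ x ∈ U, h (t, x) = σ (G (t, φ x))) ∧ ∀ t, ∀ x ∉ U, h (t, x) = x := by
  classical
  refine ⟨fun z => if z.2 ∈ U then σ (G (z.1, φ z.2)) else z.2, ?_,
    fun t x hx => if_pos hx, fun t x hx => if_neg hx⟩
  refine contMDiff_of_eq_snd hU hK hKU ?_ fun t x hx => ?_
  · have h1 : ContMDiffOn (𝓘(ℝ, ℝ).prod I) 𝓘(ℝ, ℝ × E') ∞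
        (fun z : ℝ × M => (z.1, φ z.2)) (univ ×ˢ U) :=
      contMDiffOn_fst.prodMk_space (hφ.comp contMDiffOn_snd fun z hz => hz.2)
    have h2 := hσ.comp (hG.contMDiff.comp_contMDiffOn h1) fun z hz => hGT z.1 z.2 hz.2
    exact h2.congr fun z hz => if_pos hz.2
  · by_cases hxU : x ∈ U
    · simp only [if_pos hxU, hGK t x hxU hx, hσφ x hxU]
    · exact if_neg hxU

/-- If a compact set can locally be strictly descended, then it can be globally. -/
theorem exists_isDescendingHomotopy_lt_of_isCompact {K : Set M} (hK : IsCompact K)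
    (hloc : ∀ x ∈ K, ∃ h, IsDescendingHomotopy I f e h ∧ ∀ᶠ y in 𝓝 x, f (h (0, y)) < f y) :
    ∃ h, IsDescendingHomotopy I f e h ∧ ∀ x ∈ K, f (h (0, x)) < f x := by
  refine hK.induction_on (p := fun S => ∃ h, IsDescendingHomotopy I f e h ∧
    ∀ x ∈ S, f (h (0, x)) < f x) ⟨_, isDescendingHomotopy_snd, by simp⟩ ?_ ?_ ?_
  · rintro s t hst ⟨h, hh, hlt⟩
    exact ⟨h, hh, fun x hx => hlt x (hst hx)⟩
  · rintro s t ⟨h₁, hh₁, hlt₁⟩ ⟨h₂, hh₂, hlt₂⟩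
    exact ⟨_, hh₁.comp hh₂, fun x hx => hh₁.comp_lt hh₂ (hx.imp (hlt₁ x) (hlt₂ x))⟩
  · intro x hx
    obtain ⟨h, hh, hlt⟩ := hloc x hx
    exact ⟨_, mem_nhdsWithin_of_mem_nhds hlt, h, hh, fun y hy => hy⟩

/-- Iterating a descending homotopy which is strict on the part of `{f ≤ d}` that is not sent to
an invariant set `A` sends all of `{f ≤ d}` to `A`. -/
theorem IsDescendingHomotopy.exists_mapsTo [CompactSpace M] (hf : Continuous f)
    {h : ℝ × M → M} (hh : IsDescendingHomotopy I f e h) {A C : Set M} {a d : ℝ} (hC : IsOpen C)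
    (haA : sublevel f a ⊆ A) (hA : ∀ x ∈ A, h (0, x) ∈ A) (hCA : ∀ x ∈ C, h (0, x) ∈ A)
    (hlt : ∀ x, f x ∈ Icc a d → x ∉ C → f (h (0, x)) < f x) :
    ∃ g, IsDescendingHomotopy I f e g ∧ ∀ x ∈ sublevel f d, g (0, x) ∈ A := by
  -- The drop of `f` is continuous and positive on a compact set, hence bounded below; if the set is
  -- empty any `δ` will do.
  obtain ⟨δ, hδ, hδK⟩ : ∃ δ > 0, ∀ x, f x ∈ Icc a d → x ∉ C → f (h (0, x)) ≤ f x - δ := by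
    have hK : IsCompact (f ⁻¹' Icc a d ∩ Cᶜ) :=
      ((isClosed_Icc.preimage hf).inter hC.isClosed_compl).isCompact
    rcases (f ⁻¹' Icc a d ∩ Cᶜ).eq_empty_or_nonempty with hemp | hne
    · refine ⟨1, one_pos, fun x hx hxC => ?_⟩
      have : x ∈ f ⁻¹' Icc a d ∩ Cᶜ := ⟨hx, hxC⟩
      rw [hemp] at this
      exact this.elim
    · have hc : Continuous fun x => f x - f (h (0, x)) :=
        hf.sub (hf.comp (hh.smooth.continuous.comp (by fun_prop)))
      obtain ⟨x₀, hx₀, hmin⟩ := hK.exists_isMinOn hne hc.continuousOn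
      refine ⟨f x₀ - f (h (0, x₀)), sub_pos.2 (hlt x₀ hx₀.1 hx₀.2), fun x hx hxC => ?_⟩
      have : f x₀ - f (h (0, x₀)) ≤ f x - f (h (0, x)) := hmin ⟨hx, hxC⟩
      linarith
  -- A point that reaches `A` stays there; otherwise each step costs at least `δ`, so the level `a`,
  -- below which everything is in `A`, is reached in finitely many steps.
  have hiter : ∀ N : ℕ, ∃ g, IsDescendingHomotopy I f e g ∧
      ∀ x ∈ sublevel f d, g (0, x) ∈ A ∨ f (g (0, x)) ≤ d - N * δ := by
    intro N
    induction N with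
    | zero =>
      refine ⟨_, isDescendingHomotopy_snd, fun x hx => Or.inr ?_⟩
      have h1 : f x ≤ d := hx
      simpa using h1
    | succ N ih =>
      obtain ⟨g, hg, hgA⟩ := ih
      refine ⟨_, hh.comp hg, fun x hx => ?_⟩
      rcases hgA x hx with h1 | h1
      · exact Or.inl (hA _ h1)
      · by_cases h2 : f (g (0, x)) ≤ a
        · exact Or.inl (hA _ (haA h2))
        by_cases h3 : g (0, x) ∈ C
        · exact Or.inl (hCA _ h3)
        have h4 := hδK (g (0, x)) ⟨(not_le.1 h2).le, (hg.le 0 x).trans hx⟩ h3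
        refine Or.inr ?_
        push_cast
        linarith
  obtain ⟨N, hN⟩ := exists_nat_gt ((d - a) / δ)
  obtain ⟨g, hg, hgA⟩ := hiter N
  refine ⟨g, hg, fun x hx => (hgA x hx).elim id fun h1 => haA ?_⟩
  rw [div_lt_iff₀ hδ] at hN
  exact h1.trans (by linarith)

end DescendingHomotopy

/-! ### Local descent at regular points. -/

section Push

variable {E : Type*} [NormedAddCommGroup E] [NormedSpace ℝ E]
  {H : Type*} [TopologicalSpace H] {I : ModelWithCorners ℝ E H}
  {M : Type*} [TopologicalSpace M] [T2Space M] [ChartedSpace H M] [IsManifold I ∞ M]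

/-- A function with negative derivative in the direction `v` decreases along segments. -/
theorem apply_add_smul_lt {F : E → ℝ} {R : Set E} {z v : E} {s : ℝ} (hs : 0 < s)
    (hR : ∀ u ∈ Icc 0 s, z + u • v ∈ R)
    (hF : ∀ u ∈ Icc 0 s, DifferentiableWithinAt ℝ F R (z + u • v))
    (hneg : ∀ u ∈ Icc 0 s, fderivWithin ℝ F R (z + u • v) v < 0) : F (z + s • v) < F z := by
  have hd : ∀ u ∈ Icc 0 s, HasDerivWithinAt (fun u : ℝ => F (z + u • v))
      (fderivWithin ℝ F R (z + u • v) v) (Icc 0 s) u := fun u hu => by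
    have h2 : HasDerivAt (fun u : ℝ => z + u • v) v u := by
      simpa using ((hasDerivAt_id u).smul_const v).const_add z
    exact (hF u hu).hasFDerivWithinAt.comp_hasDerivWithinAt u h2.hasDerivWithinAt hR
  obtain ⟨u, hu, hslope⟩ := exists_hasDerivAt_eq_slope (fun u : ℝ => F (z + u • v))
    (fun u => fderivWithin ℝ F R (z + u • v) v) hs (fun u hu => (hd u hu).continuousWithinAt)
    (fun u hu => (hd u (Ioo_subset_Icc_self hu)).hasDerivAt (Icc_mem_nhds hu.1 hu.2))
  have h1 := hneg u (Ioo_subset_Icc_self hu)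
  rw [hslope, div_lt_iff₀ (by linarith)] at h1
  simp only [zero_smul, add_zero, zero_mul] at h1
  linarith

/-- Near a point where `f` decreases in a direction `v` along which the model does not leave its
range, `f` can be strictly decreased by a homotopy supported away from a given closed set. -/
theorem exists_push [FiniteDimensional ℝ E] {f : M → ℝ}
    (hf : ContMDiff I 𝓘(ℝ, ℝ) ∞ f) {e : Set M} (he : IsClosed e)
    {q : M} (hq : q ∉ e) {v : E} {δ : ℝ} (hδ : 0 < δ) (hRc : IsClosed (range I))
    (hv : ∀ z ∈ range I, dist z (extChartAt I q q) < δ → ∀ s ∈ Icc 0 δ, z + s • v ∈ range I)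
    (hneg : fderivWithin ℝ (f ∘ (extChartAt I q).symm) (range I) (extChartAt I q q) v < 0) :
    ∃ h, IsDescendingHomotopy I f e h ∧ ∀ᶠ y in 𝓝 q, f (h (0, y)) < f y := by
  set φ := extChartAt I q with hφ
  set F := f ∘ φ.symm with hFdef
  have hFc : ContDiffOn ℝ ∞ F φ.target := by
    rw [← contMDiffOn_iff_contDiffOn]
    exact hf.comp_contMDiffOn (contMDiffOn_extChartAt_symm q)
  have htarget : φ.target ∈ 𝓝[range I] (φ q) := extChartAt_target_mem_nhdsWithin q
  have hFat : ∀ z ∈ φ.target, ContDiffWithinAt ℝ ∞ F (range I) z := fun z hz =>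
    (hFc z hz).mono_of_mem_nhdsWithin (extChartAt_target_mem_nhdsWithin_of_mem hz)
  have hnegn : ∀ᶠ z in 𝓝[range I] (φ q), fderivWithin ℝ F (range I) z v < 0 := by
    have h1 : ContinuousWithinAt (fderivWithin ℝ F (range I)) (range I) (φ q) :=
      ((hFat _ (mem_extChartAt_target q)).fderivWithin_right (m := 0) I.uniqueDiffOn (by simp)
        (mem_range_self _)).continuousWithinAt
    exact (h1.clm_apply continuousWithinAt_const).eventually (gt_mem_nhds hneg)
  have hen : ∀ᶠ z in 𝓝[range I] (φ q), φ.symm z ∉ e := by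
    have h1 : ContinuousWithinAt φ.symm (range I) (φ q) :=
      (continuousAt_extChartAt_symm q).continuousWithinAt
    refine h1.eventually (he.isOpen_compl.mem_nhds ?_)
    simpa [hφ] using hq
  obtain ⟨ρ₁, hρ₁, hρS₁⟩ := Metric.mem_nhdsWithin_iff.1
    (inter_mem (inter_mem htarget hnegn) hen)
  let ρ := min ρ₁ δ
  have hρ : 0 < ρ := lt_min hρ₁ hδ
  have hρδ : ρ ≤ δ := min_le_right _ _
  have hρS : ∀ z ∈ Metric.ball (φ q) ρ, z ∈ range I →
      z ∈ φ.target ∧ fderivWithin ℝ F (range I) z v < 0 ∧ φ.symm z ∉ e := fun z hz hzR => by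
    have h1 := hρS₁ ⟨Metric.ball_subset_ball (min_le_left _ _) hz, hzR⟩
    exact ⟨h1.1.1, h1.1.2, h1.2⟩
  -- The cutoff vanishes outside radius `ρ / 2` and displacements are shorter than `ρ / 2`, so moved
  -- points stay within radius `ρ`, where the direction `v` remains one of descent.
  let b : ContDiffBump (φ q) := ⟨ρ / 3, ρ / 2, by positivity, by linarith⟩
  obtain ⟨s₀, hs₀, hs₀δ, hs₀v⟩ : ∃ s₀ > 0, s₀ ≤ δ ∧ s₀ * ‖v‖ < ρ / 2 := by
    refine ⟨min δ (ρ / 2 / (‖v‖ + 1)), by positivity, min_le_left _ _, ?_⟩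
    have h1 : 0 < ‖v‖ + 1 := by positivity
    calc min δ (ρ / 2 / (‖v‖ + 1)) * ‖v‖ ≤ ρ / 2 / (‖v‖ + 1) * ‖v‖ := by
          gcongr; exact min_le_right _ _
      _ < ρ / 2 / (‖v‖ + 1) * (‖v‖ + 1) := by gcongr; linarith
      _ = ρ / 2 := by field_simp
  have hmove : ∀ z ∈ range I, z ∈ Metric.ball (φ q) (ρ / 2) → ∀ s ∈ Icc 0 s₀,
      z + s • v ∈ Metric.ball (φ q) ρ ∧ z + s • v ∈ range I := fun z hz hzb s hs => by
    rw [Metric.mem_ball] at hzb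
    refine ⟨?_, hv z hz (by linarith) s ⟨hs.1, hs.2.trans hs₀δ⟩⟩
    rw [Metric.mem_ball]
    have h1 : dist (z + s • v) z ≤ s₀ * ‖v‖ := by
      rw [dist_eq_norm, add_sub_cancel_left, norm_smul, Real.norm_of_nonneg hs.1]
      gcongr
      exact hs.2
    linarith [dist_triangle (z + s • v) z (φ q)]
  -- `τ 0 = 1` and `τ 1 = 0`, with values in `[0, 1]` for all real times, so the homotopy is smooth
  -- on all of `ℝ × M`.
  let τ : ℝ → ℝ := fun t => Real.smoothTransition (1 - t)
  let G : ℝ × E → E := fun z => z.2 + (s₀ * τ z.1 * b z.2) • v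
  have hτ : ContDiff ℝ ∞ τ := Real.smoothTransition.contDiff.comp (contDiff_const.sub contDiff_id)
  have hG : ContDiff ℝ ∞ G := contDiff_snd.add (((contDiff_const.mul (hτ.comp contDiff_fst)).mul
    (b.contDiff.comp contDiff_snd)).smul contDiff_const)
  have hcoef : ∀ t z, s₀ * τ t * b z ∈ Icc 0 s₀ := fun t z => by
    have h1 : 0 ≤ τ t := Real.smoothTransition.nonneg _
    have h2 : τ t ≤ 1 := Real.smoothTransition.le_one _
    have h3 : 0 ≤ b z := b.nonneg
    have h4 : b z ≤ 1 := b.le_one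
    refine ⟨by positivity, ?_⟩
    calc s₀ * τ t * b z ≤ s₀ * 1 * 1 := by gcongr
      _ = s₀ := by ring
  have hb0 : ∀ z ∉ Metric.ball (φ q) (ρ / 2), b z = 0 := fun z hz => by
    have : z ∉ Function.support b := by rwa [b.support_eq]
    exact Function.notMem_support.1 this
  have hrange : ∀ x, φ x ∈ range I := fun x => by
    rw [hφ, extChartAt_coe]; exact mem_range_self _
  have hGT : ∀ t, ∀ x ∈ φ.source, G (t, φ x) ∈ φ.target := fun t x hx => by
    by_cases hz : φ x ∈ Metric.ball (φ q) (ρ / 2)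
    · have h1 := hmove _ (hrange x) hz _ (hcoef t (φ x))
      exact (hρS _ h1.1 h1.2).1
    · simpa [G, hb0 _ hz] using φ.map_source hx
  have hsub : Metric.closedBall (φ q) (ρ / 2) ∩ range I ⊆ φ.target := fun z hz =>
    (hρS z (Metric.closedBall_subset_ball (by linarith) hz.1) hz.2).1
  -- Closedness of `range I` makes the support compact, hence closed in the Hausdorff space `M`,
  -- even at the boundary.
  have hKc : IsCompact (φ.symm '' (Metric.closedBall (φ q) (ρ / 2) ∩ range I)) :=
    ((isCompact_closedBall _ _).inter_right hRc).image_of_continuousOn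
      ((continuousOn_extChartAt_symm q).mono hsub)
  obtain ⟨h, hsm, hin, hout⟩ := exists_contMDiff_of_coordinates (isOpen_extChartAt_source q)
    hKc.isClosed (by rintro _ ⟨z, hz, rfl⟩; exact φ.map_target (hsub hz))
    (by rw [extChartAt_source]; exact contMDiffOn_extChartAt) (contMDiffOn_extChartAt_symm q)
    (fun x hx => φ.left_inv hx) hG hGT (fun t x hx hxK => by
      have hz : φ x ∉ Metric.ball (φ q) (ρ / 2) := fun hz =>
        hxK ⟨φ x, ⟨Metric.ball_subset_closedBall hz, hrange x⟩, φ.left_inv hx⟩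
      change φ x + (s₀ * τ t * b (φ x)) • v = φ x
      rw [hb0 _ hz, mul_zero, zero_smul, add_zero])
  have hstep : ∀ t, ∀ x ∈ φ.source, 0 < s₀ * τ t * b (φ x) → f (h (t, x)) < f x := by
    intro t x hx hpos
    have hz : φ x ∈ Metric.ball (φ q) (ρ / 2) := by
      by_contra hz
      rw [hb0 _ hz, mul_zero] at hpos
      exact hpos.false
    have hm : ∀ u ∈ Icc 0 (s₀ * τ t * b (φ x)), _ := fun u hu =>
      hmove _ (hrange x) hz u ⟨hu.1, hu.2.trans (hcoef t (φ x)).2⟩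
    have h1 := apply_add_smul_lt (F := F) (v := v) hpos (fun u hu => (hm u hu).2)
      (fun u hu => (hFat _ (hρS _ (hm u hu).1 (hm u hu).2).1).differentiableWithinAt (by simp))
      (fun u hu => (hρS _ (hm u hu).1 (hm u hu).2).2.1)
    have h2 : F (φ x) = f x := congrArg f (φ.left_inv hx)
    rw [h2] at h1
    rw [hin t x hx]
    exact h1
  have hstay : ∀ t, ∀ x ∈ φ.source, s₀ * τ t * b (φ x) = 0 → h (t, x) = x := by
    intro t x hx h0
    rw [hin t x hx]
    change φ.symm (φ x + (s₀ * τ t * b (φ x)) • v) = x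
    rw [h0, zero_smul, add_zero, φ.left_inv hx]
  have halt : ∀ t x, h (t, x) = x ∨ f (h (t, x)) < f x := by
    intro t x
    by_cases hx : x ∈ φ.source
    · rcases (hcoef t (φ x)).1.eq_or_lt with h0 | h0
      · exact Or.inl (hstay t x hx h0.symm)
      · exact Or.inr (hstep t x hx h0)
    · exact Or.inl (hout t x hx)
  refine ⟨h, ⟨hsm, fun x => ?_, fun t x => ?_, fun x hxe => ?_, halt 0⟩, ?_⟩
  · by_cases hx : x ∈ φ.source
    · exact hstay 1 x hx (by simp [τ])
    · exact hout 1 x hx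
  · rcases halt t x with h1 | h1
    · rw [h1]
    · exact h1.le
  · by_cases hx : x ∈ φ.source
    · refine hstay 0 x hx ?_
      rw [hb0, mul_zero]
      intro hz
      refine (hρS _ (Metric.ball_subset_ball (by linarith) hz) (hrange x)).2.2 ?_
      rwa [φ.left_inv hx]
    · exact hout 0 x hx
  · filter_upwards [extChartAt_source_mem_nhds (I := I) q,
      (continuousAt_extChartAt q).preimage_mem_nhds (Metric.ball_mem_nhds (φ q) (half_pos hρ))]
      with y hy hyb
    refine hstep 0 y hy ?_
    have h1 : 0 < b (φ y) := b.pos_of_mem_ball hyb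
    have h2 : τ 0 = 1 := by simp [τ]
    rw [h2]
    positivity

end Push

/-! ### The Morse neighbourhood: its collapse and the cell. -/

section Collapse

variable {E : Type*} [NormedAddCommGroup E] [NormedSpace ℝ E]
  {H : Type*} [TopologicalSpace H] {I : ModelWithCorners ℝ E H}
  {M : Type*} [TopologicalSpace M] [ChartedSpace H M]
  {X Y : Type*} [NormedAddCommGroup X] [NormedSpace ℝ X] [NormedAddCommGroup Y] [NormedSpace ℝ Y]

/-- Near a point where `f` is `c - ‖x‖² + ‖y‖²` in coordinates, a descending homotopy collapses
a neighbourhood to the disk `y = 0`. -/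
theorem exists_collapse [T2Space M] [FiniteDimensional ℝ X] [FiniteDimensional ℝ Y] {f : M → ℝ}
    {c r : ℝ} (hr : 0 < r) {θ : M → X × Y}
    {ψ : X × Y → M} (hψ : ContMDiffOn 𝓘(ℝ, X × Y) I ∞ ψ (Metric.ball 0 r))
    (hθψ : ∀ z ∈ Metric.ball 0 r, θ (ψ z) = z) (hU : IsOpen (ψ '' Metric.ball 0 r))
    (hθ : ContMDiffOn I 𝓘(ℝ, X × Y) ∞ θ (ψ '' Metric.ball 0 r))
    (hf : ∀ z ∈ Metric.ball 0 r, f (ψ z) = c - ‖z.1‖ ^ 2 + ‖z.2‖ ^ 2) :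
    ∃ h, IsDescendingHomotopy I f (ψ '' {z | z ∈ Metric.ball 0 r ∧ z.2 = 0}) h ∧
      ∀ z ∈ Metric.ball 0 (r / 3), h (0, ψ z) = ψ (z.1, 0) := by
  let b : ContDiffBump (0 : X × Y) := ⟨r / 3, r / 2, by positivity, by linarith⟩
  let τ : ℝ → ℝ := fun t => Real.smoothTransition (1 - t)
  -- Only the `y` component contracts, and it enters `f` as `+‖y‖²`, so `f` drops exactly where
  -- points move. Where the cutoff is 1, time 0 kills `y` entirely.
  let G : ℝ × (X × Y) → X × Y := fun z => (z.2.1, (1 - τ z.1 * b z.2) • z.2.2)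
  have hτ : ContDiff ℝ ∞ τ := Real.smoothTransition.contDiff.comp (contDiff_const.sub contDiff_id)
  have hG : ContDiff ℝ ∞ G := (contDiff_fst.comp contDiff_snd).prodMk
    ((contDiff_const.sub ((hτ.comp contDiff_fst).mul (b.contDiff.comp contDiff_snd))).smul
      (contDiff_snd.comp contDiff_snd))
  have hcoef : ∀ t z, 1 - τ t * b z ∈ Icc 0 1 := fun t z => by
    have h1 : 0 ≤ τ t := Real.smoothTransition.nonneg _
    have h2 : τ t ≤ 1 := Real.smoothTransition.le_one _
    have h3 : 0 ≤ b z := b.nonneg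
    have h4 : b z ≤ 1 := b.le_one
    constructor <;> nlinarith
  -- The product carries the sup norm, so shrinking one component cannot leave the ball.
  have hGT : ∀ t, ∀ z ∈ Metric.ball (0 : X × Y) r, G (t, z) ∈ Metric.ball (0 : X × Y) r := by
    intro t z hz
    rw [mem_ball_zero_iff] at hz ⊢
    refine lt_of_le_of_lt (max_le (norm_fst_le z) ?_) hz
    rw [norm_smul, Real.norm_of_nonneg (hcoef t z).1]
    exact (mul_le_of_le_one_left (norm_nonneg _) (hcoef t z).2).trans (norm_snd_le z)
  have hsub : Metric.closedBall (0 : X × Y) (r / 2) ⊆ Metric.ball 0 r :=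
    Metric.closedBall_subset_ball (by linarith)
  have hK : IsCompact (ψ '' Metric.closedBall (0 : X × Y) (r / 2)) :=
    (isCompact_closedBall _ _).image_of_continuousOn (hψ.continuousOn.mono hsub)
  obtain ⟨h, hsm, hin, hout⟩ := exists_contMDiff_of_coordinates hU hK.isClosed (image_mono hsub) hθ
    hψ (by rintro _ ⟨z, hz, rfl⟩; rw [hθψ z hz]) hG
    (by rintro t _ ⟨z, hz, rfl⟩; rw [hθψ z hz]; exact hGT t z hz)
    (by
      rintro t _ ⟨z, hz, rfl⟩ hzK
      rw [hθψ z hz]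
      have hb : b z = 0 := by
        have : z ∉ Function.support b := by
          rw [b.support_eq]
          exact fun h => hzK ⟨z, Metric.ball_subset_closedBall h, rfl⟩
        exact Function.notMem_support.1 this
      simp [G, hb])
  have hin' : ∀ t, ∀ z ∈ Metric.ball (0 : X × Y) r,
      h (t, ψ z) = ψ (z.1, (1 - τ t * b z) • z.2) := fun t z hz => by
    rw [hin t _ ⟨z, hz, rfl⟩, hθψ z hz]
  have halt : ∀ t x, h (t, x) = x ∨ f (h (t, x)) < f x := by
    intro t x
    by_cases hx : x ∈ ψ '' Metric.ball 0 r
    · obtain ⟨z, hz, rfl⟩ := hx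
      by_cases h0 : (1 - τ t * b z) • z.2 = z.2
      · exact Or.inl (by rw [hin' t z hz, h0])
      · right
        rw [hin' t z hz, hf z hz, hf _ (hGT t z hz), norm_smul,
          Real.norm_of_nonneg (hcoef t z).1]
        have hz2 : 0 < ‖z.2‖ := norm_pos_iff.2 fun h2 => h0 (by rw [h2, smul_zero])
        have hc1 : 1 - τ t * b z < 1 := lt_of_le_of_ne (hcoef t z).2 fun h2 =>
          h0 (by rw [h2, one_smul])
        have h3 : (1 - τ t * b z) * ‖z.2‖ < ‖z.2‖ := mul_lt_of_lt_one_left hz2 hc1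
        have h4 := pow_lt_pow_left₀ h3 (mul_nonneg (hcoef t z).1 hz2.le) two_ne_zero
        linarith
    · exact Or.inl (hout t x hx)
  refine ⟨h, ⟨hsm, fun x => ?_, fun t x => ?_, ?_, halt 0⟩, fun z hz => ?_⟩
  · by_cases hx : x ∈ ψ '' Metric.ball 0 r
    · obtain ⟨z, hz, rfl⟩ := hx
      rw [hin' 1 z hz]
      simp [τ]
    · exact hout 1 x hx
  · rcases halt t x with h1 | h1
    · rw [h1]
    · exact h1.le
  · rintro _ ⟨z, ⟨hz, hz2⟩, rfl⟩
    rw [hin' 0 z hz, hz2, smul_zero, ← hz2]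
  · have hb : b z = 1 := b.one_of_mem_closedBall (Metric.ball_subset_closedBall hz)
    have hτ0 : τ 0 = 1 := by simp [τ]
    rw [hin' 0 z (Metric.ball_subset_ball (by linarith) hz), hb, hτ0]
    simp

/-- The disk of radius `√ε` in the negative directions is a cell attached to `{f ≤ c - ε}`. -/
theorem isAttachedCell_of_chart [IsManifold I ∞ M] {k : ℕ} {f : M → ℝ} {c r ε : ℝ} (hε : 0 < ε)
    (hεr : √ε < r) {θ : M → EuclideanSpace ℝ (Fin k) × Y}
    {ψ : EuclideanSpace ℝ (Fin k) × Y → M}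
    (hψ : ContMDiffOn 𝓘(ℝ, EuclideanSpace ℝ (Fin k) × Y) I ∞ ψ (Metric.ball 0 r))
    (hθψ : ∀ z ∈ Metric.ball 0 r, θ (ψ z) = z)
    (hθ : ContMDiffOn I 𝓘(ℝ, EuclideanSpace ℝ (Fin k) × Y) ∞ θ (ψ '' Metric.ball 0 r))
    (hf : ∀ z ∈ Metric.ball 0 r, f (ψ z) = c - ‖z.1‖ ^ 2 + ‖z.2‖ ^ 2) :
    IsAttachedCell I k (sublevel f (c - ε))
      ((fun u : EuclideanSpace ℝ (Fin k) => ψ (√ε • u, 0)) '' Metric.closedBall 0 1) := by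
  have hsε : 0 < √ε := Real.sqrt_pos.2 hε
  let ι : EuclideanSpace ℝ (Fin k) →L[ℝ] EuclideanSpace ℝ (Fin k) × Y :=
    √ε • ContinuousLinearMap.inl ℝ _ _
  have hι : ∀ u, ι u = (√ε • u, 0) := fun u => by simp [ι]
  have hιinj : Function.Injective ι := fun u w huw => by
    rw [hι, hι, Prod.mk.injEq] at huw
    exact smul_right_injective _ hsε.ne' huw.1
  have hmaps : ∀ u ∈ Metric.closedBall (0 : EuclideanSpace ℝ (Fin k)) 1,
      ι u ∈ Metric.ball (0 : EuclideanSpace ℝ (Fin k) × Y) r := fun u hu => by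
    rw [mem_closedBall_zero_iff] at hu
    rw [mem_ball_zero_iff, hι, Prod.norm_mk, norm_zero, max_eq_left (norm_nonneg _), norm_smul,
      Real.norm_of_nonneg hsε.le]
    exact (mul_le_of_le_one_right hsε.le hu).trans_lt hεr
  have hfΦ : ∀ u ∈ Metric.closedBall (0 : EuclideanSpace ℝ (Fin k)) 1,
      f (ψ (√ε • u, 0)) = c - ε * ‖u‖ ^ 2 := fun u hu => by
    have := hf _ (hmaps u hu)
    rw [hι] at this
    rw [this, norm_smul, mul_pow, Real.norm_of_nonneg hsε.le, Real.sq_sqrt hε.le]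
    simp
  have hΦ : ContMDiffOn 𝓘(ℝ, EuclideanSpace ℝ (Fin k)) I ∞ (fun u => ψ (√ε • u, 0))
      (Metric.closedBall (0 : EuclideanSpace ℝ (Fin k)) 1) := by
    refine (hψ.comp ι.contMDiff.contMDiffOn hmaps).congr fun u _ => ?_
    rw [Function.comp_apply, hι]
  have hθΦ : ∀ u ∈ Metric.closedBall (0 : EuclideanSpace ℝ (Fin k)) 1,
      θ (ψ (√ε • u, 0)) = ι u := fun u hu => by
    rw [← hι, hθψ _ (hmaps u hu)]
  refine ⟨_, hΦ, fun u hu w hw huw => hιinj ?_, fun u hu => ?_, rfl, ?_⟩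
  · have huw' : ψ (√ε • u, 0) = ψ (√ε • w, 0) := huw
    rw [← hθΦ u hu, ← hθΦ w hw, huw']
  · have huniq : UniqueDiffWithinAt ℝ (Metric.closedBall (0 : EuclideanSpace ℝ (Fin k)) 1) u :=
      uniqueDiffOn_convex (convex_closedBall _ _) (by
        rw [interior_closedBall _ one_ne_zero]
        exact ⟨0, Metric.mem_ball_self one_pos⟩) u hu
    have hmap : Metric.closedBall (0 : EuclideanSpace ℝ (Fin k)) 1 ⊆
        (fun w => ψ (√ε • w, 0)) ⁻¹'
          (ψ '' Metric.ball (0 : EuclideanSpace ℝ (Fin k) × Y) r) := fun w hw =>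
      ⟨_, hmaps w hw, by rw [hι]⟩
    -- On the ball `θ` composed with the parametrization is the injective linear map `ι`; the chain
    -- rule then makes the differential of the parametrization injective.
    have hcomp := mfderivWithin_comp (I := 𝓘(ℝ, EuclideanSpace ℝ (Fin k))) (I' := I)
      (I'' := 𝓘(ℝ, EuclideanSpace ℝ (Fin k) × Y)) u
      ((hθ _ (hmap hu)).mdifferentiableWithinAt (by simp))
      ((hΦ u hu).mdifferentiableWithinAt (by simp)) hmap huniq.uniqueMDiffWithinAt
    have hlin : mfderivWithin 𝓘(ℝ, EuclideanSpace ℝ (Fin k))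
        𝓘(ℝ, EuclideanSpace ℝ (Fin k) × Y) (θ ∘ fun u => ψ (√ε • u, 0))
        (Metric.closedBall (0 : EuclideanSpace ℝ (Fin k)) 1) u = ι := by
      rw [mfderivWithin_eq_fderivWithin]
      exact (fderivWithin_congr (f := ι) hθΦ (hθΦ u hu)).trans (ι.fderivWithin huniq)
    rw [hlin] at hcomp
    intro v w hvw
    refine hιinj ?_
    have h1 := DFunLike.congr_fun hcomp v
    have h2 := DFunLike.congr_fun hcomp w
    refine h1.trans (Eq.trans ?_ h2.symm)
    exact congrArg (mfderivWithin I 𝓘(ℝ, EuclideanSpace ℝ (Fin k) × Y) θ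
      (ψ '' Metric.ball 0 r) (ψ (√ε • u, 0))) hvw
  · ext x
    constructor
    · rintro ⟨⟨u, hu, rfl⟩, hx⟩
      refine ⟨u, ?_, rfl⟩
      have hx' : f (ψ (√ε • u, 0)) ≤ c - ε := hx
      rw [hfΦ u hu] at hx'
      rw [mem_closedBall_zero_iff] at hu
      rw [mem_sphere_zero_iff_norm]
      refine le_antisymm hu ?_
      have h1 : 1 ≤ ‖u‖ ^ 2 := by
        have : ε * 1 ≤ ε * ‖u‖ ^ 2 := by linarith
        exact le_of_mul_le_mul_left this hε
      nlinarith [norm_nonneg u]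
    · rintro ⟨u, hu, rfl⟩
      have hu' := Metric.sphere_subset_closedBall hu
      refine ⟨⟨u, hu', rfl⟩, ?_⟩
      change f (ψ (√ε • u, 0)) ≤ c - ε
      rw [hfΦ u hu', mem_sphere_zero_iff_norm.1 hu]
      simp

end Collapse

/-! ### Descent directions in the half-space model. -/

section HalfSpace

variable {n : ℕ} [NeZero n] {M : Type*} [TopologicalSpace M]
  [ChartedSpace (EuclideanHalfSpace n) M]

/-- At a regular point, which is a maximum if it is on the boundary, there is a direction of
descent that does not leave the manifold. -/
theorem exists_descent_direction {f : M → ℝ} (hf : ContMDiff (𝓡∂ n) 𝓘(ℝ, ℝ) ∞ f) {q : M}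
    (hq : ¬ IsCriticalPt (𝓡∂ n) f q)
    (hmax : q ∈ (𝓡∂ n).boundary M → ∀ x, f x ≤ f q) :
    ∃ v : EuclideanSpace ℝ (Fin n), ∃ δ > 0,
      (∀ z ∈ range (𝓡∂ n), dist z (extChartAt (𝓡∂ n) q q) < δ →
        ∀ s ∈ Icc 0 δ, z + s • v ∈ range (𝓡∂ n)) ∧
      fderivWithin ℝ (f ∘ (extChartAt (𝓡∂ n) q).symm) (range (𝓡∂ n))
        (extChartAt (𝓡∂ n) q q) v < 0 := by
  set φ := extChartAt (𝓡∂ n) q with hφ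
  have hD : fderivWithin ℝ (f ∘ φ.symm) (range (𝓡∂ n)) (φ q) ≠ 0 := fun h => by
    refine hq ?_
    rw [IsCriticalPt, (hf.mdifferentiable (by simp) q).mfderiv]
    exact h
  obtain ⟨w, hw⟩ : ∃ w, fderivWithin ℝ (f ∘ φ.symm) (range (𝓡∂ n)) (φ q) w ≠ 0 := by
    by_contra! h
    exact hD (ContinuousLinearMap.ext h)
  generalize hDD : fderivWithin ℝ (f ∘ φ.symm) (range (𝓡∂ n)) (φ q) = D at *
  rcases (𝓡∂ n).isInteriorPoint_or_isBoundaryPoint q with hi | hb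
  · obtain ⟨v, hv⟩ : ∃ v, D v < 0 := by
      rcases hw.lt_or_gt with h | h
      · exact ⟨w, h⟩
      · exact ⟨-w, by rw [map_neg]; linarith⟩
    obtain ⟨ρ, hρ, hρR⟩ := Metric.mem_nhds_iff.1 (mem_interior_iff_mem_nhds.1 hi)
    have h1 : 0 < ‖v‖ + 1 := by positivity
    refine ⟨v, ρ / 2 / (‖v‖ + 1), by positivity, fun z _ hz s hs => hρR ?_, hv⟩
    rw [Metric.mem_ball]
    have h2 : dist (z + s • v) z ≤ ρ / 2 / (‖v‖ + 1) * ‖v‖ := by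
      rw [dist_eq_norm, add_sub_cancel_left, norm_smul, Real.norm_of_nonneg hs.1]
      gcongr
      exact hs.2
    have h3 : ρ / 2 / (‖v‖ + 1) * ‖v‖ + ρ / 2 / (‖v‖ + 1) = ρ / 2 := by field_simp
    linarith [dist_triangle (z + s • v) z (φ q)]
  · have hR : range (𝓡∂ n) = {y | 0 ≤ y 0} := range_modelWithCornersEuclideanHalfSpace n
    have hcone : ∀ z ∈ range (𝓡∂ n), ∀ v : EuclideanSpace ℝ (Fin n), 0 ≤ v 0 → ∀ s : ℝ, 0 ≤ s →
        z + s • v ∈ range (𝓡∂ n) := fun z hz v hv s hs => by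
      rw [hR] at hz ⊢
      have hz' : 0 ≤ z 0 := hz
      change 0 ≤ z 0 + s * v 0
      positivity
    have hqR : φ q ∈ range (𝓡∂ n) := by rw [hφ, extChartAt_coe]; exact mem_range_self _
    -- At a maximum the derivative is nonpositive along every direction staying in the half-space.
    have hnonpos : ∀ v : EuclideanSpace ℝ (Fin n), 0 ≤ v 0 → D v ≤ 0 := fun v hv => by
      have hloc : IsLocalMaxOn (f ∘ φ.symm) (range (𝓡∂ n)) (φ q) :=
        Eventually.of_forall fun z => by
          have h1 : (f ∘ φ.symm) (φ q) = f q :=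
            congrArg f (φ.left_inv (mem_extChartAt_source q))
          rw [h1]
          exact hmax hb _
      rw [← hDD]
      refine hloc.fderivWithin_nonpos (mem_posTangentConeAt_of_segment_subset ?_)
      rw [segment_eq_image']
      rintro _ ⟨s, hs, rfl⟩
      simpa using hcone _ hqR v hv s hs.1
    -- One of `w` and `-w` lies in the half-space, and `D` vanishes on neither, so nonpositivity
    -- becomes strict.
    obtain ⟨v, hv0, hv⟩ : ∃ v : EuclideanSpace ℝ (Fin n), 0 ≤ v 0 ∧ D v ≠ 0 := by
      rcases le_total 0 (w 0) with h | h
      · exact ⟨w, h, hw⟩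
      · exact ⟨-w, by simpa using h, by simpa using hw⟩
    exact ⟨v, 1, one_pos, fun z hz _ s hs => hcone z hz v hv0 s hs.1,
      lt_of_le_of_ne (hnonpos v hv0) hv⟩

end HalfSpace

/-! ### Assembly of the deformation. -/

theorem mainTheorem12 {n : ℕ} [NeZero n]
    {M : Type*} [TopologicalSpace M] [T2Space M] [CompactSpace M]
    [ChartedSpace (EuclideanHalfSpace n) M] [IsManifold (𝓡∂ n) ∞ M]
    (hboundary : ((𝓡∂ n).boundary M).Nonempty)
    (f : M → ℝ) (hf01 : ∀ x, f x ∈ Set.Icc (0 : ℝ) 1)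
    (hmorse : IsMorseFunction (𝓡∂ n) f)
    (hf1 : f ⁻¹' {1} = (𝓡∂ n).boundary M)
    (hmax : ∀ x ∈ (𝓡∂ n).interior M, ¬ IsLocalMax f x)
    (c d : ℝ) (hc : 0 ≤ c) (hcd : c < d) (hd : d ≤ 1)
    (k : ℕ) (hk : k < n)
    (p : M) (hpc : f p = c) (hp : IsCriticalPt (𝓡∂ n) f p) (hpk : morseIndex (𝓡∂ n) f p = k)
    (ε₁ : ℝ) (hε₁ : 0 < ε₁)
    (hcrit : ∀ x ∈ f ⁻¹' Set.Icc (c - ε₁) d, IsCriticalPt (𝓡∂ n) f x → x = p) :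
    ∃ ε₀ > 0, ∀ ε : ℝ, 0 < ε → ε < ε₀ →
      ∃ h : ℝ × M → M,
        ContMDiffOn (𝓘(ℝ, ℝ).prod (𝓡∂ n)) (𝓡∂ n) ∞ h (Set.Icc (0 : ℝ) 1 ×ˢ sublevel f d) ∧
        (∀ t ∈ Set.Icc (0 : ℝ) 1, ∀ x ∈ sublevel f d, h (t, x) ∈ sublevel f d) ∧
        (∀ x ∈ sublevel f d, h (1, x) = x) ∧
        ∃ e : Set M, e ⊆ sublevel f d ∧
          IsAttachedCell (𝓡∂ n) k (sublevel f (c - ε)) e ∧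
          ∀ x ∈ sublevel f d, h (0, x) ∈ sublevel f (c - ε) ∪ e := by
  subst hpk hpc
  have hf := hmorse.smooth
  have hpi : (𝓡∂ n).IsInteriorPoint p := by
    rcases (𝓡∂ n).isInteriorPoint_or_isBoundaryPoint p with h | h
    · exact h
    · have h1 : p ∈ f ⁻¹' {1} := by rw [hf1]; exact h
      have h2 : f p = 1 := h1
      linarith
  obtain ⟨m, θ, ψ, r, hr, hψ0, hψ, hθψ, hU, hθ, hfψ⟩ :=
    exists_morse_chart hf hpi hp (hmorse.nondegenerate p hp)
  -- The bound `ε₁` keeps other critical points out of the slab; `(r / 3) ^ 2` places the disk of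
  -- radius `√ε` inside the ball where the collapse is complete.
  refine ⟨min ε₁ ((r / 3) ^ 2), by positivity, fun ε hε hεlt => ?_⟩
  have hεε₁ : ε < ε₁ := hεlt.trans_le (min_le_left _ _)
  have hsε : 0 < √ε := Real.sqrt_pos.2 hε
  have hεr : √ε < r / 3 :=
    (Real.sqrt_lt' (by positivity)).2 (hεlt.trans_le (min_le_right _ _))
  obtain ⟨h₀, hh₀, hcol⟩ := exists_collapse hr hψ hθψ hU hθ hfψ
  have hcell := isAttachedCell_of_chart hε (hεr.trans (by linarith)) hψ hθψ hθ hfψ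
  set Φ : EuclideanSpace ℝ (Fin (morseIndex (𝓡∂ n) f p)) → M := fun u => ψ (√ε • u, 0) with hΦ
  set e : Set M := Φ '' Metric.closedBall 0 1 with he
  have hΦnorm : ∀ u ∈ Metric.closedBall (0 : EuclideanSpace ℝ (Fin (morseIndex (𝓡∂ n) f p))) 1,
      ((√ε • u, 0) : _ × EuclideanSpace ℝ (Fin m)) ∈ Metric.ball 0 (r / 3) := fun u hu => by
    rw [mem_closedBall_zero_iff] at hu
    rw [mem_ball_zero_iff, Prod.norm_mk, norm_zero, max_eq_left (norm_nonneg _), norm_smul,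
      Real.norm_of_nonneg hsε.le]
    exact (mul_le_of_le_one_right hsε.le hu).trans_lt hεr
  have hr3 : Metric.ball (0 : EuclideanSpace ℝ (Fin (morseIndex (𝓡∂ n) f p)) ×
      EuclideanSpace ℝ (Fin m)) (r / 3) ⊆ Metric.ball 0 r :=
    Metric.ball_subset_ball (by linarith)
  have hee : e ⊆ ψ '' {z | z ∈ Metric.ball 0 r ∧ z.2 = 0} := by
    rintro _ ⟨u, hu, rfl⟩
    exact ⟨_, ⟨hr3 (hΦnorm u hu), rfl⟩, rfl⟩
  have hec : IsClosed e := by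
    obtain ⟨Φ', hΦ', -, -, himg, -⟩ := hcell
    rw [← himg]
    exact ((isCompact_closedBall _ _).image_of_continuousOn hΦ'.continuousOn).isClosed
  have hed : e ⊆ sublevel f d := by
    intro x hx
    obtain ⟨z, ⟨hz, hz2⟩, rfl⟩ := hee hx
    change f (ψ z) ≤ d
    rw [hfψ z hz, hz2, norm_zero]
    nlinarith [sq_nonneg ‖z.1‖]
  set C : Set M := ψ '' Metric.ball 0 r ∩ θ ⁻¹' Metric.ball 0 (r / 3) with hCdef
  have hC : IsOpen C := hθ.continuousOn.isOpen_inter_preimage hU Metric.isOpen_ball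
  have heC : e ⊆ C := by
    rintro _ ⟨u, hu, rfl⟩
    refine ⟨⟨_, hr3 (hΦnorm u hu), rfl⟩, ?_⟩
    rw [mem_preimage, hΦ, hθψ _ (hr3 (hΦnorm u hu))]
    exact hΦnorm u hu
  have hpC : p ∈ C := by
    refine heC ⟨0, Metric.mem_closedBall_self zero_le_one, ?_⟩
    simp only [hΦ, smul_zero]
    exact hψ0
  have hK : IsCompact (f ⁻¹' Icc (f p - ε) d ∩ Cᶜ) :=
    ((isClosed_Icc.preimage hf.continuous).inter hC.isClosed_compl).isCompact
  obtain ⟨h₁, hh₁, hlt₁⟩ := exists_isDescendingHomotopy_lt_of_isCompact (I := 𝓡∂ n) (f := f)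
    (e := e) hK (by
      rintro x ⟨hx, hxC⟩
      have hxcrit : ¬ IsCriticalPt (𝓡∂ n) f x := fun h => by
        have h1 := hcrit x ⟨by linarith [hx.1], hx.2⟩ h
        rw [h1] at hxC
        exact hxC hpC
      obtain ⟨v, δ, hδ, hv, hneg⟩ := exists_descent_direction hf hxcrit (fun hxb y => by
        have h1 : x ∈ f ⁻¹' {1} := by rw [hf1]; exact hxb
        have h2 : f x = 1 := h1
        rw [h2]
        exact (hf01 y).2)
      refine exists_push hf hec (fun h => hxC (heC h)) hδ ?_ hv hneg
      rw [range_modelWithCornersEuclideanHalfSpace]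
      exact isClosed_le continuous_const (by fun_prop))
  have hh₀e := hh₀.mono hee
  have hA₁ : ∀ x ∈ sublevel f (f p - ε) ∪ e, h₁ (0, x) ∈ sublevel f (f p - ε) ∪ e := by
    rintro x (hx | hx)
    · exact Or.inl ((hh₁.le 0 x).trans hx)
    · exact Or.inr (by rwa [hh₁.fix x hx])
  have hA₀ : ∀ x ∈ sublevel f (f p - ε) ∪ e, h₀ (0, x) ∈ sublevel f (f p - ε) ∪ e := by
    rintro x (hx | hx)
    · exact Or.inl ((hh₀.le 0 x).trans hx)
    · exact Or.inr (by rwa [hh₀e.fix x hx])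
  -- A collapsed point `(x, 0)` lies on the cell if `‖x‖ ≤ √ε`; otherwise its value `c - ‖x‖²` is
  -- below `c - ε`.
  have hC₀ : ∀ x ∈ C, h₀ (0, x) ∈ sublevel f (f p - ε) ∪ e := by
    rintro _ ⟨⟨z, hz, rfl⟩, hzC⟩
    rw [mem_preimage, hθψ z hz] at hzC
    rw [hcol z hzC]
    by_cases hz1 : ‖z.1‖ ≤ √ε
    · refine Or.inr ⟨(√ε)⁻¹ • z.1, ?_, ?_⟩
      · rw [mem_closedBall_zero_iff, norm_smul, norm_inv, Real.norm_of_nonneg hsε.le,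
          inv_mul_le_iff₀ hsε, mul_one]
        exact hz1
      · simp only [hΦ]
        rw [smul_inv_smul₀ hsε.ne']
    · left
      have hz' : ((z.1, 0) : _ × EuclideanSpace ℝ (Fin m)) ∈ Metric.ball 0 r := by
        rw [mem_ball_zero_iff] at hz ⊢
        rw [Prod.norm_mk, norm_zero, max_eq_left (norm_nonneg _)]
        exact (norm_fst_le z).trans_lt hz
      change f (ψ (z.1, 0)) ≤ f p - ε
      rw [hfψ _ hz', norm_zero]
      have h1 := pow_le_pow_left₀ hsε.le (not_le.1 hz1).le 2
      rw [Real.sq_sqrt hε.le] at h1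
      linarith
  -- The collapse acts first: it sends `C` into the target set, which the push then preserves.
  obtain ⟨g, hg, hgA⟩ := (hh₁.comp hh₀e).exists_mapsTo hf.continuous (a := f p - ε) (d := d) hC
    (subset_union_left (t := e)) (fun x hx => hA₁ _ (hA₀ x hx)) (fun x hx => hA₁ _ (hC₀ x hx))
    (fun x hx hxC => hh₁.comp_lt hh₀e (Or.inl (hlt₁ x ⟨hx, hxC⟩)))
  exact ⟨g, hg.smooth.contMDiffOn, fun t _ x hx => (hg.le t x).trans hx, fun x _ => hg.one x,
    e, hed, hcell, hgA⟩
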